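/- Conventions. All $C^*$-algebras are complex. An $A$-$B$-equivalence bimodule $X$ over $C^*$-algebras $A$, $B$ is a full left Hilbert $A$-module and a full right Hilbert $B$-module (complete, both inner products inducing the same norm; fullness means that the inner products span dense subspaces of $A$ and of $B$, respectively), with commuting actions of $A$ and $B$ by operators that are adjointable for the inner product of the other side, and with ${}_A\langle x,y\rangle\cdot z=x\cdot\langle y,z\rangle_B$ for all $x,y,z\in X$. $A$ and $B$ are strongly Morita equivalent if such an $X$ exists. Representations $\pi_A$ of $A$ on a Hilbert space $H$ and $\pi_B$ of $B$ on a Hilbert space $K$ are strongly Morita equivalent if they are non-degenerate and there are an $A$-$B$-equivalence bimodule $X$ and a linear map $\pi_X:X\to\mathbf B(K,H)$ such that, for all $a\in A$, $b\in B$, $x,y\in X$, $$\pi_X(x)\pi_X(y)^*=\pi_A({}_A\langle x,y\rangle),\qquad \pi_X(x)^*\pi_X(y)=\pi_B(\langle x,y\rangle_B),\qquad \pi_X(a\cdot x\cdot b)=\pi_A(a)\pi_X(x)\pi_B(b).$$ A completely positive map on $A$ is a completely positive linear map $\phi:A\to\mathbf B(H)$ for some complex Hilbert space $H$, where $H$ may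 vary with $\phi$. A minimal Stinespring representation of $\phi$ consists of a Hilbert space $H_\phi$, a representation $\pi_\phi$ of $A$ on $H_\phi$ and a bounded operator $V_\phi:H\to H_\phi$ such that $\phi(a)=V_\phi^*\pi_\phi(a)V_\phi$ for all $a\in A$ and $\pi_\phi(A)V_\phi H$ spans a dense subspace of $H_\phi$. Completely positive maps $\phi$ on $A$ and $\psi$ on $B$ are strongly Morita equivalent if they have minimal Stinespring representations whose representations $\pi_\phi$ and $\pi_\psi$ are strongly Morita equivalent. Statement. Let $A$ and $B$ be unital $C^*$-algebras that are strongly Morita equivalent. Then strong Morita equivalence is an equivalence relation on the completely positive maps on $A$ and on the completely positive maps on $B$, and there is a bijection $e$ from the strong Morita equivalence classes of completely positive maps on $A$ onto those of completely positive maps on $B$ such that corresponding classes are strongly Morita equivalent: for all completely positive maps $\phi$ on $A$ and $\psi$ on $B$, $e([\phi])=[\psi]$ if and only if $\phi$ is strongly Morita equivalent to $\psi$. -/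

import Mathlib

open scoped ComplexOrder InnerProductSpace CStarAlgebra

universe u

namespace CStarMorita

/-- An `A`-`B`-equivalence bimodule (imprimitivity bimodule) over C*-algebras `A` and `B`: a Banach
space that is a full left Hilbert `A`-module and a full right Hilbert `B`-module, on which each
algebra acts by adjointable operators with respect to the inner product of the other side, and whose
inner products satisfy `⟨x, y⟩_A • z = x • ⟨y, z⟩_B`. The left inner product is linear in its first
variable, the right one in its second. Definiteness of the two inner products follows from the
fact that each of them induces the norm. For unital `A` or `B`, that the unit acts
as the identity also follows. -/
structure EquivalenceBimodule (A B : Type u)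
    [NonUnitalCStarAlgebra A] [PartialOrder A] [StarOrderedRing A]
    [NonUnitalCStarAlgebra B] [PartialOrder B] [StarOrderedRing B] where
  /-- the underlying Banach space -/
  carrier : Type u
  [normedAddCommGroup : NormedAddCommGroup carrier]
  [normedSpace : NormedSpace ℂ carrier]
  [completeSpace : CompleteSpace carrier]
  /-- the left action `a • x` -/
  lact : A →ₗ[ℂ] carrier →ₗ[ℂ] carrier
  /-- the right action `x • b` -/
  ract : carrier →ₗ[ℂ] B →ₗ[ℂ] carrier
  /-- the left inner product, with values in `A` -/
  linner : carrier →ₗ[ℂ] carrier →ₗ⋆[ℂ] A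
  /-- the right inner product, with values in `B` -/
  rinner : carrier →ₗ⋆[ℂ] carrier →ₗ[ℂ] B
  lact_mul (a a' : A) (x : carrier) : lact (a * a') x = lact a (lact a' x)
  ract_mul (x : carrier) (b b' : B) : ract x (b * b') = ract (ract x b) b'
  lact_ract (a : A) (x : carrier) (b : B) : lact a (ract x b) = ract (lact a x) b
  star_linner (x y : carrier) : star (linner x y) = linner y x
  star_rinner (x y : carrier) : star (rinner x y) = rinner y x
  linner_lact (a : A) (x y : carrier) : linner (lact a x) y = a * linner x y
  rinner_ract (x y : carrier) (b : B) : rinner x (ract y b) = rinner x y * b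
  linner_self_nonneg (x : carrier) : 0 ≤ linner x x
  rinner_self_nonneg (x : carrier) : 0 ≤ rinner x x
  norm_sq_eq_norm_linner (x : carrier) : ‖x‖ ^ 2 = ‖linner x x‖
  norm_sq_eq_norm_rinner (x : carrier) : ‖x‖ ^ 2 = ‖rinner x x‖
  linner_ract (x y : carrier) (b : B) : linner (ract x b) y = linner x (ract y (star b))
  rinner_lact (a : A) (x y : carrier) : rinner (lact a x) y = rinner x (lact (star a) y)
  lact_linner (x y z : carrier) : lact (linner x y) z = ract x (rinner y z)
  linner_full :
    (Submodule.span ℂ {a : A | ∃ x y : carrier, a = linner x y}).topologicalClosure = ⊤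
  rinner_full :
    (Submodule.span ℂ {b : B | ∃ x y : carrier, b = rinner x y}).topologicalClosure = ⊤

attribute [instance] EquivalenceBimodule.normedAddCommGroup EquivalenceBimodule.normedSpace
  EquivalenceBimodule.completeSpace

/-- Strong Morita equivalence of C*-algebras. -/
def StronglyMoritaEquivalent (A B : Type u)
    [NonUnitalCStarAlgebra A] [PartialOrder A] [StarOrderedRing A]
    [NonUnitalCStarAlgebra B] [PartialOrder B] [StarOrderedRing B] : Prop :=
  Nonempty (EquivalenceBimodule A B)

/-- A representation `π` of a C*-algebra on `H` is non-degenerate if `π(A)H` spans a dense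
subspace of `H`. -/
def IsNondegenerate {A H : Type u} [NonUnitalCStarAlgebra A]
    [NormedAddCommGroup H] [InnerProductSpace ℂ H] [CompleteSpace H]
    (π : A →⋆ₙₐ[ℂ] (H →L[ℂ] H)) : Prop :=
  (Submodule.span ℂ {ξ : H | ∃ (a : A) (h : H), ξ = π a h}).topologicalClosure = ⊤

section Representations

variable {A B : Type u}
  [NonUnitalCStarAlgebra A] [PartialOrder A] [StarOrderedRing A]
  [NonUnitalCStarAlgebra B] [PartialOrder B] [StarOrderedRing B]
  {H K : Type u}
  [NormedAddCommGroup H] [InnerProductSpace ℂ H] [CompleteSpace H]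
  [NormedAddCommGroup K] [InnerProductSpace ℂ K] [CompleteSpace K]

/-- The triple `(πA, πX, πB)` is a representation of the equivalence bimodule `X` on the pair of
Hilbert spaces `(H, K)`. -/
structure IsBimoduleRepresentation (X : EquivalenceBimodule A B)
    (πA : A →⋆ₙₐ[ℂ] (H →L[ℂ] H)) (πX : X.carrier →ₗ[ℂ] (K →L[ℂ] H))
    (πB : B →⋆ₙₐ[ℂ] (K →L[ℂ] K)) : Prop where
  nondegenerate_left : IsNondegenerate πA
  nondegenerate_right : IsNondegenerate πB
  comp_adjoint (x y : X.carrier) :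
    πX x ∘L ContinuousLinearMap.adjoint (πX y) = πA (X.linner x y)
  adjoint_comp (x y : X.carrier) :
    ContinuousLinearMap.adjoint (πX x) ∘L πX y = πB (X.rinner x y)
  map_act (a : A) (x : X.carrier) (b : B) :
    πX (X.ract (X.lact a x) b) = πA a ∘L πX x ∘L πB b

/-- Strong Morita equivalence of non-degenerate representations of C*-algebras. -/
def RepStronglyMoritaEquivalent
    (πA : A →⋆ₙₐ[ℂ] (H →L[ℂ] H)) (πB : B →⋆ₙₐ[ℂ] (K →L[ℂ] K)) : Prop :=
  ∃ (X : EquivalenceBimodule A B) (πX : X.carrier →ₗ[ℂ] (K →L[ℂ] H)),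
    IsBimoduleRepresentation X πA πX πB

end Representations

/-- A completely positive linear map on `A`: a completely positive linear map from `A` to the
C*-algebra of all bounded operators on some complex Hilbert space. -/
structure CPMapOn (A : Type u) [NonUnitalCStarAlgebra A] [PartialOrder A] [StarOrderedRing A] where
  /-- the Hilbert space -/
  space : Type u
  [normedAddCommGroup : NormedAddCommGroup space]
  [innerProductSpace : InnerProductSpace ℂ space]
  [completeSpace : CompleteSpace space]
  /-- the completely positive linear map -/
  map : A →CP (space →L[ℂ] space)

attribute [instance] CPMapOn.normedAddCommGroup CPMapOn.innerProductSpace CPMapOn.completeSpace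

section CompletelyPositive

variable {A B : Type u}
  [NonUnitalCStarAlgebra A] [PartialOrder A] [StarOrderedRing A]
  [NonUnitalCStarAlgebra B] [PartialOrder B] [StarOrderedRing B]

/-- A minimal Stinespring representation `(π, V, E)` of a completely positive linear map `φ`:
`φ(a) = V* π(a) V`, and `π(A)VH` spans a dense subspace of `E`.
The norm identity `‖V‖ ^ 2 = ‖φ‖` is a consequence. -/
structure MinimalStinespring (φ : CPMapOn A) where
  /-- the dilation Hilbert space -/
  space : Type u
  [normedAddCommGroup : NormedAddCommGroup space]
  [innerProductSpace : InnerProductSpace ℂ space]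
  [completeSpace : CompleteSpace space]
  /-- the representation of `A` on the dilation space -/
  rep : A →⋆ₙₐ[ℂ] (space →L[ℂ] space)
  /-- the dilating operator -/
  V : φ.space →L[ℂ] space
  map_eq (a : A) : φ.map a = ContinuousLinearMap.adjoint V ∘L rep a ∘L V
  dense_span : (Submodule.span ℂ
    {ξ : space | ∃ (a : A) (h : φ.space), ξ = rep a (V h)}).topologicalClosure = ⊤

attribute [instance] MinimalStinespring.normedAddCommGroup MinimalStinespring.innerProductSpace
  MinimalStinespring.completeSpace

/-- Strong Morita equivalence of completely positive linear maps (possibly on different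
C*-algebras): their minimal Stinespring representations are strongly Morita equivalent. -/
def CPStronglyMoritaEquivalent (φ : CPMapOn A) (ψ : CPMapOn B) : Prop :=
  ∃ (S : MinimalStinespring φ) (T : MinimalStinespring ψ),
    RepStronglyMoritaEquivalent S.rep T.rep

end CompletelyPositive

/-- The collection of strong Morita equivalence classes of completely positive linear maps
on `A`. -/
def CPClasses (A : Type u) [NonUnitalCStarAlgebra A] [PartialOrder A] [StarOrderedRing A] :
    Type (u + 1) :=
  Quot (fun φ φ' : CPMapOn A => CPStronglyMoritaEquivalent φ φ')

/-- The strong Morita equivalence class of a completely positive linear map on `A`. -/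
def CPMapOn.toClass {A : Type u} [NonUnitalCStarAlgebra A] [PartialOrder A] [StarOrderedRing A]
    (φ : CPMapOn A) : CPClasses A :=
  Quot.mk _ φ

end CStarMorita

/-! The argument rests on two facts: strong Morita equivalence is reflexive, symmetric and
transitive across unital algebras, and every completely positive map on `A` is equivalent to some
map on `B`. The bijection is then formal: send the class of a map to the class of any map on `B`
equivalent to it.

Symmetry comes from the conjugate bimodule, represented by adjoint operators. For transitivity of
representations (`RepStronglyMoritaEquivalent.trans`) one forms `X ⊗_B Y`, represented by `x ⊗ y ↦
πX(x) πY(y)`. For completely positive maps the middle map may come with two different minimal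
Stinespring representations; these are unitarily equivalent (`MinimalStinespring.exists_unitary`),
so one can be replaced by the other. Reflexivity needs a minimal Stinespring representation to
exist; it is read off from the reproducing kernel Hilbert space of `(a, b) ↦ φ(a* b)`.

To move a map from `A` to `B`, its Stinespring representation is induced through `X`
(`exists_repStronglyMoritaEquivalent`). The resulting representation of `B` is itself a completely
positive map and its own minimal dilation.

Unitality keeps all constructions finite: `exists_linner_frame` provides finitely many `f i` with `∑
⟨f i, f i⟩ = 1`. With such frames on both sides, tensor products need no completion, the norm and
its completeness follow from algebraic data, and induced representations live on a subspace of a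
finite power of `H`. -/

namespace CStarMorita

/-! ### Conjugate bimodules and finite Parseval frames -/

namespace EquivalenceBimodule

section NonUnital

variable {A B : Type u}
  [NonUnitalCStarAlgebra A] [PartialOrder A] [StarOrderedRing A]
  [NonUnitalCStarAlgebra B] [PartialOrder B] [StarOrderedRing B]
  (X : EquivalenceBimodule A B)

lemma linner_lact_right (a : A) (x y : X.carrier) :
    X.linner x (X.lact a y) = X.linner x y * star a := by
  rw [← X.star_linner, X.linner_lact, star_mul, X.star_linner]

lemma rinner_ract_left (x y : X.carrier) (b : B) :
    X.rinner (X.ract x b) y = star b * X.rinner x y := by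
  rw [← X.star_rinner, X.rinner_ract, star_mul, X.star_rinner]

lemma eq_zero_of_linner_self {x : X.carrier} (h : X.linner x x = 0) : x = 0 := by
  have := X.norm_sq_eq_norm_linner x
  rw [h, norm_zero] at this
  exact norm_eq_zero.mp (pow_eq_zero_iff two_ne_zero |>.mp this)

lemma eq_zero_of_rinner_self {x : X.carrier} (h : X.rinner x x = 0) : x = 0 := by
  have := X.norm_sq_eq_norm_rinner x
  rw [h, norm_zero] at this
  exact norm_eq_zero.mp (pow_eq_zero_iff two_ne_zero |>.mp this)

/-- The underlying space of an equivalence bimodule with the conjugate scalar multiplication. -/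
def ConjCarrier : Type u := X.carrier

noncomputable instance : NormedAddCommGroup X.ConjCarrier :=
  inferInstanceAs (NormedAddCommGroup X.carrier)

instance : CompleteSpace X.ConjCarrier := inferInstanceAs (CompleteSpace X.carrier)

noncomputable instance : NormedSpace ℂ X.ConjCarrier where
  toModule := Module.compHom X.carrier (starRingEnd ℂ)
  norm_smul_le c x := by
    change ‖(starRingEnd ℂ c) • (show X.carrier from x)‖ ≤ ‖c‖ * ‖(show X.carrier from x)‖
    rw [norm_smul, RCLike.norm_conj]

/-- The identity map onto the conjugate space. -/
noncomputable def toConj : X.carrier →ₗ⋆[ℂ] X.ConjCarrier where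
  toFun x := x
  map_add' _ _ := rfl
  map_smul' c x := by
    change c • x = (starRingEnd ℂ (starRingEnd ℂ c)) • x
    simp

/-- The identity map from the conjugate space. -/
noncomputable def ofConj : X.ConjCarrier →ₗ⋆[ℂ] X.carrier where
  toFun x := x
  map_add' _ _ := rfl
  map_smul' _ _ := rfl

/-- The inverse (conjugate) of an equivalence bimodule. -/
noncomputable def conj : EquivalenceBimodule B A where
  carrier := X.ConjCarrier
  lact := LinearMap.mk₂ ℂ (fun b x => X.toConj (X.ract (X.ofConj x) (star b)))
    (by simp) (by simp) (by simp) (by simp)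
  ract := LinearMap.mk₂ ℂ (fun x a => X.toConj (X.lact (star a) (X.ofConj x)))
    (by simp) (by simp) (by simp) (by simp)
  linner := LinearMap.mk₂'ₛₗ (RingHom.id ℂ) (starRingEnd ℂ)
    (fun x y => X.rinner (X.ofConj x) (X.ofConj y)) (by simp) (by simp) (by simp) (by simp)
  rinner := LinearMap.mk₂'ₛₗ (starRingEnd ℂ) (RingHom.id ℂ)
    (fun x y => X.linner (X.ofConj x) (X.ofConj y)) (by simp) (by simp) (by simp) (by simp)
  lact_mul b b' x := by
    change X.ract _ _ = X.ract (X.ract _ _) _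
    rw [star_mul, X.ract_mul]
  ract_mul x a a' := by
    change X.lact _ _ = X.lact _ (X.lact _ _)
    rw [star_mul, X.lact_mul]
  lact_ract b x a := (X.lact_ract _ _ _).symm
  star_linner x y := X.star_rinner _ _
  star_rinner x y := X.star_linner _ _
  linner_lact b x y := by
    change X.rinner (X.ract (X.ofConj x) (star b)) (X.ofConj y) = b * X.rinner _ (X.ofConj y)
    rw [X.rinner_ract_left, star_star]
  rinner_ract x y a := by
    change X.linner (X.ofConj x) (X.lact (star a) (X.ofConj y)) = X.linner _ (X.ofConj y) * a
    rw [X.linner_lact_right, star_star]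
  linner_self_nonneg x := X.rinner_self_nonneg _
  rinner_self_nonneg x := X.linner_self_nonneg _
  norm_sq_eq_norm_linner x := X.norm_sq_eq_norm_rinner _
  norm_sq_eq_norm_rinner x := X.norm_sq_eq_norm_linner _
  linner_ract x y a := X.rinner_lact _ _ _
  rinner_lact b x y := X.linner_ract _ _ _
  lact_linner x y z := by
    change X.ract (X.ofConj z) (star (X.rinner (X.ofConj x) (X.ofConj y))) =
      X.lact (star (X.linner (X.ofConj y) (X.ofConj z))) (X.ofConj x)
    rw [X.star_linner, X.star_rinner]
    exact (X.lact_linner _ _ _).symm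
  linner_full := X.rinner_full
  rinner_full := X.linner_full

/-- The adjoint of a representation of an equivalence bimodule represents its conjugate. -/
lemma _root_.CStarMorita.RepStronglyMoritaEquivalent.symm {H K : Type u}
    [NormedAddCommGroup H] [InnerProductSpace ℂ H] [CompleteSpace H]
    [NormedAddCommGroup K] [InnerProductSpace ℂ K] [CompleteSpace K]
    {πA : A →⋆ₙₐ[ℂ] (H →L[ℂ] H)} {πB : B →⋆ₙₐ[ℂ] (K →L[ℂ] K)}
    (h : RepStronglyMoritaEquivalent πA πB) : RepStronglyMoritaEquivalent πB πA := by
  obtain ⟨X, πX, hX⟩ := h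
  refine ⟨X.conj, (ContinuousLinearMap.adjoint (𝕜 := ℂ) (E := K) (F := H)).toLinearEquiv.toLinearMap
    ∘ₛₗ (πX ∘ₛₗ X.ofConj), ⟨hX.nondegenerate_right, hX.nondegenerate_left, ?_, ?_, ?_⟩⟩
  · intro x y
    change ContinuousLinearMap.adjoint (πX _) ∘L
      ContinuousLinearMap.adjoint (ContinuousLinearMap.adjoint (πX _)) = _
    rw [ContinuousLinearMap.adjoint_adjoint]
    exact hX.adjoint_comp _ _
  · intro x y
    change ContinuousLinearMap.adjoint (ContinuousLinearMap.adjoint (πX _)) ∘L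
      ContinuousLinearMap.adjoint (πX _) = _
    rw [ContinuousLinearMap.adjoint_adjoint]
    exact hX.comp_adjoint _ _
  · intro b x a
    change ContinuousLinearMap.adjoint (πX (X.lact (star a) (X.ract _ (star b)))) =
      πB b ∘L ContinuousLinearMap.adjoint (πX (X.ofConj x)) ∘L πA a
    rw [X.lact_ract, hX.map_act, ContinuousLinearMap.adjoint_comp,
      ContinuousLinearMap.adjoint_comp, map_star πA, map_star πB,
      ContinuousLinearMap.star_eq_adjoint, ContinuousLinearMap.star_eq_adjoint,
      ContinuousLinearMap.adjoint_adjoint, ContinuousLinearMap.adjoint_adjoint]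
    rfl

end NonUnital

section Unital

variable {A B : Type u}
  [CStarAlgebra A] [PartialOrder A] [StarOrderedRing A]
  [CStarAlgebra B] [PartialOrder B] [StarOrderedRing B]
  (X : EquivalenceBimodule A B)

lemma lact_one (x : X.carrier) : X.lact 1 x = x := by
  rw [← sub_eq_zero]
  apply X.eq_zero_of_linner_self
  simp [X.linner_lact, X.linner_lact_right]

lemma ract_one (x : X.carrier) : X.ract x 1 = x := by
  rw [← sub_eq_zero]
  apply X.eq_zero_of_rinner_self
  simp [X.rinner_ract, X.rinner_ract_left]

lemma exists_list_of_mem_span {t : A}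
    (ht : t ∈ Submodule.span ℂ {a : A | ∃ x y : X.carrier, a = X.linner x y}) :
    ∃ l : List (X.carrier × X.carrier), t = (l.map fun p => X.linner p.1 p.2).sum := by
  induction ht using Submodule.span_induction with
  | mem t ht =>
    obtain ⟨x, y, rfl⟩ := ht
    exact ⟨[(x, y)], by simp⟩
  | zero => exact ⟨[], by simp⟩
  | add s t _ _ hs ht =>
    obtain ⟨l, rfl⟩ := hs
    obtain ⟨l', rfl⟩ := ht
    exact ⟨l ++ l', by simp⟩
  | smul c t _ ht =>
    obtain ⟨l, rfl⟩ := ht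
    refine ⟨l.map fun p => (c • p.1, p.2), ?_⟩
    rw [List.smul_sum]
    simp [Function.comp_def]

/-- Every equivalence bimodule over unital C*-algebras has a finite Parseval frame for its left
inner product. -/
lemma exists_linner_frame :
    ∃ (n : ℕ) (f : Fin n → X.carrier), ∑ i, X.linner (f i) (f i) = 1 := by
  have h1 : (1 : A) ∈ (Submodule.span ℂ
      {a : A | ∃ x y : X.carrier, a = X.linner x y}).topologicalClosure := by
    rw [X.linner_full]; trivial
  -- A sum of left inner products at distance less than 1 from the unit is invertible; letting its
  -- inverse act on the first entries makes the sum exactly 1.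
  obtain ⟨t, ht, htd⟩ := Metric.mem_closure_iff.mp h1 1 one_pos
  obtain ⟨l, rfl⟩ := X.exists_list_of_mem_span ht
  set t := (l.map fun p => X.linner p.1 p.2).sum with htdef
  have hu : IsUnit t := by
    have := isUnit_one_sub_of_norm_lt_one (x := 1 - t) (by rwa [dist_eq_norm] at htd)
    simpa using this
  obtain ⟨w, hw⟩ := hu
  set l₁ : List (X.carrier × X.carrier) := l.map fun p => (X.lact (↑w⁻¹ : A) p.1, p.2)
  have hl₁ : (l₁.map fun p => X.linner p.1 p.2).sum = 1 := by
    have : (l₁.map fun p => X.linner p.1 p.2).sum = (↑w⁻¹ : A) * t := by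
      rw [htdef, ← List.sum_map_mul_left]
      simp [l₁, Function.comp_def, X.linner_lact]
    rw [this, ← hw, Units.inv_mul]
  -- Positivity of `⟨x - y, x - y⟩` bounds the mixed terms by the diagonal ones.
  have key : ∀ l : List (X.carrier × X.carrier),
      (l.map fun p => X.linner p.1 p.2).sum + star (l.map fun p => X.linner p.1 p.2).sum ≤
      ((l.map Prod.fst ++ l.map Prod.snd).map fun x => X.linner x x).sum := by
    intro l
    induction l with
    | nil => simp
    | cons p l ih =>
      have h0 := X.linner_self_nonneg (p.1 - p.2)
      simp only [map_sub, LinearMap.sub_apply] at h0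
      have h2 : X.linner p.1 p.2 + X.linner p.2 p.1 ≤ X.linner p.1 p.1 + X.linner p.2 p.2 := by
        rw [← sub_nonneg]
        convert h0 using 1
        abel
      have h3 := add_le_add h2 ih
      simp only [List.map_cons, List.sum_cons, star_add, X.star_linner, List.map_append,
        List.sum_append] at h3 ⊢
      refine le_of_eq_of_le ?_ (h3.trans_eq ?_) <;> abel
  set l₂ := l₁.map Prod.fst ++ l₁.map Prod.snd
  set s := (l₂.map fun x => X.linner x x).sum with hs
  have hs1 : (1 : A) + 1 ≤ s := by
    have := key l₁
    rwa [hl₁, star_one] at this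
  -- As `s ≥ 1 + 1`, it is invertible, and `s^(-1/2)` acting on the vectors normalizes the sum of
  -- their squares to 1.
  have hpos : IsStrictlyPositive s := by
    refine IsStrictlyPositive.of_le (a := (1 : A)) (by exact isStrictlyPositive_one)
      (le_trans ?_ hs1)
    exact le_add_of_nonneg_right zero_le_one
  have hr := CFC.conjugate_rpow_neg_one_half s hpos
  set r : A := s ^ (-(1 / 2) : ℝ)
  have hrs : star r = r := (IsSelfAdjoint.of_nonneg CFC.rpow_nonneg).star_eq
  refine ⟨l₂.length, fun i => X.lact r (l₂.get i), ?_⟩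
  simp only [X.linner_lact, X.linner_lact_right, hrs]
  have hsum : s = ∑ i : Fin l₂.length, X.linner (l₂.get i) (l₂.get i) := by
    rw [hs, ← List.sum_ofFn]
    congr 1
    apply List.ext_get <;> simp
  rw [← hr, hsum, Finset.mul_sum, Finset.sum_mul]
  simp [mul_assoc]

/-- Every equivalence bimodule over unital C*-algebras has a finite Parseval frame for its right
inner product. -/
lemma exists_rinner_frame :
    ∃ (n : ℕ) (f : Fin n → X.carrier), ∑ i, X.rinner (f i) (f i) = 1 := by
  obtain ⟨n, f, hf⟩ := X.conj.exists_linner_frame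
  exact ⟨n, fun i => X.ofConj (f i), hf⟩

end Unital

end EquivalenceBimodule

end CStarMorita

/-! ### The identity bimodule and bimodules given by algebraic data -/

namespace CStarMorita

/-- A unital C*-algebra as an equivalence bimodule over itself. -/
noncomputable def EquivalenceBimodule.refl (A : Type u)
    [CStarAlgebra A] [PartialOrder A] [StarOrderedRing A] : EquivalenceBimodule A A where
  carrier := A
  lact := LinearMap.mul ℂ A
  ract := LinearMap.mul ℂ A
  linner := LinearMap.mk₂'ₛₗ (RingHom.id ℂ) (starRingEnd ℂ) (fun x y => x * star y)
    (by simp [add_mul]) (by simp) (by simp [mul_add]) (by simp)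
  rinner := LinearMap.mk₂'ₛₗ (starRingEnd ℂ) (RingHom.id ℂ) (fun x y => star x * y)
    (by simp [add_mul]) (by simp) (by simp [mul_add]) (by simp)
  lact_mul := by simp [mul_assoc]
  ract_mul := by simp [mul_assoc]
  lact_ract := by simp [mul_assoc]
  star_linner := by simp
  star_rinner := by simp
  linner_lact := by simp [mul_assoc]
  rinner_ract := by simp [mul_assoc]
  linner_self_nonneg x := by simp
  rinner_self_nonneg x := by simp
  norm_sq_eq_norm_linner x := by simp [CStarRing.norm_self_mul_star, sq]
  norm_sq_eq_norm_rinner x := by simp [CStarRing.norm_star_mul_self, sq]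
  linner_ract := by simp [mul_assoc]
  rinner_lact := by simp [mul_assoc]
  lact_linner := by simp [mul_assoc]
  linner_full := by
    rw [eq_top_iff]
    refine fun a _ => Submodule.le_topologicalClosure _ (Submodule.subset_span ⟨a, 1, by simp⟩)
  rinner_full := by
    rw [eq_top_iff]
    refine fun a _ => Submodule.le_topologicalClosure _ (Submodule.subset_span ⟨1, a, by simp⟩)

/-- A nondegenerate representation of a unital C*-algebra preserves the unit. -/
lemma IsNondegenerate.map_one {A H : Type u} [CStarAlgebra A]
    [NormedAddCommGroup H] [InnerProductSpace ℂ H] [CompleteSpace H]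
    {π : A →⋆ₙₐ[ℂ] (H →L[ℂ] H)} (h : IsNondegenerate π) : π 1 = 1 := by
  refine ContinuousLinearMap.ext_on (s := {ξ : H | ∃ (a : A) (h : H), ξ = π a h})
    (Submodule.dense_iff_topologicalClosure_eq_top.mpr h) ?_
  rintro _ ⟨a, x, rfl⟩
  change (π 1 * π a) x = π a x
  rw [← map_mul, one_mul]

/-- On the identity bimodule, `π` itself serves as the bimodule map. -/
lemma RepStronglyMoritaEquivalent.refl {A H : Type u}
    [CStarAlgebra A] [PartialOrder A] [StarOrderedRing A]
    [NormedAddCommGroup H] [InnerProductSpace ℂ H] [CompleteSpace H]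
    {π : A →⋆ₙₐ[ℂ] (H →L[ℂ] H)} (h : IsNondegenerate π) :
    RepStronglyMoritaEquivalent π π := by
  refine ⟨EquivalenceBimodule.refl A, (π : A →ₗ[ℂ] (H →L[ℂ] H)), h, h, ?_, ?_, ?_⟩
  · intro (x : A) (y : A)
    change π x * star (π y) = π (x * star y)
    rw [map_mul, map_star]
  · intro (x : A) (y : A)
    change star (π x) * π y = π (star x * y)
    rw [map_mul, map_star]
  · intro a (x : A) b
    change π (a * x * b) = π a * (π x * π b)
    rw [map_mul, map_mul, mul_assoc]

/-- The algebraic data of an equivalence bimodule over unital C*-algebras: no norm is given, and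
fullness is expressed by finite Parseval frames. -/
structure AlgebraicBimodule (A B : Type u)
    [CStarAlgebra A] [PartialOrder A] [StarOrderedRing A]
    [CStarAlgebra B] [PartialOrder B] [StarOrderedRing B] where
  /-- the underlying vector space -/
  carrier : Type u
  [addCommGroup : AddCommGroup carrier]
  [module : Module ℂ carrier]
  /-- the left action -/
  lact : A →ₗ[ℂ] carrier →ₗ[ℂ] carrier
  /-- the right action -/
  ract : carrier →ₗ[ℂ] B →ₗ[ℂ] carrier
  /-- the left inner product -/
  linner : carrier →ₗ[ℂ] carrier →ₗ⋆[ℂ] A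
  /-- the right inner product -/
  rinner : carrier →ₗ⋆[ℂ] carrier →ₗ[ℂ] B
  lact_mul (a a' : A) (x : carrier) : lact (a * a') x = lact a (lact a' x)
  ract_mul (x : carrier) (b b' : B) : ract x (b * b') = ract (ract x b) b'
  ract_one (x : carrier) : ract x 1 = x
  lact_ract (a : A) (x : carrier) (b : B) : lact a (ract x b) = ract (lact a x) b
  star_linner (x y : carrier) : star (linner x y) = linner y x
  star_rinner (x y : carrier) : star (rinner x y) = rinner y x
  linner_lact (a : A) (x y : carrier) : linner (lact a x) y = a * linner x y
  rinner_ract (x y : carrier) (b : B) : rinner x (ract y b) = rinner x y * b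
  linner_self_nonneg (x : carrier) : 0 ≤ linner x x
  rinner_self_nonneg (x : carrier) : 0 ≤ rinner x x
  linner_self_definite (x : carrier) : linner x x = 0 → x = 0
  linner_ract (x y : carrier) (b : B) : linner (ract x b) y = linner x (ract y (star b))
  rinner_lact (a : A) (x y : carrier) : rinner (lact a x) y = rinner x (lact (star a) y)
  lact_linner (x y z : carrier) : lact (linner x y) z = ract x (rinner y z)
  linner_frame : ∃ (n : ℕ) (f : Fin n → carrier), ∑ i, linner (f i) (f i) = 1
  rinner_frame : ∃ (n : ℕ) (f : Fin n → carrier), ∑ i, rinner (f i) (f i) = 1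

namespace AlgebraicBimodule

attribute [instance] AlgebraicBimodule.addCommGroup AlgebraicBimodule.module

variable {A B : Type u}
  [CStarAlgebra A] [PartialOrder A] [StarOrderedRing A]
  [CStarAlgebra B] [PartialOrder B] [StarOrderedRing B]
  (X : AlgebraicBimodule A B)

noncomputable instance : SMul A X.carrier := ⟨fun a x => X.lact a x⟩

noncomputable instance : Norm X.carrier := ⟨fun x => √‖X.linner x x‖⟩

noncomputable instance : CStarModule A X.carrier where
  -- The arguments are swapped because `CStarModule` is linear in the second variable, `linner` in
  -- the first.
  inner x y := X.linner y x
  inner_add_right {x y z} := by simp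
  inner_self_nonneg {x} := X.linner_self_nonneg x
  inner_self {x} := ⟨X.linner_self_definite x, fun h => by simp [h]⟩
  inner_op_smul_right {a x y} := X.linner_lact a y x
  inner_smul_right_complex {z x y} := by simp
  star_inner x y := X.star_linner y x
  norm_eq_sqrt_norm_inner_self x := rfl

noncomputable instance : NormedAddCommGroup X.carrier := CStarModule.normedAddCommGroup A

noncomputable instance : NormedSpace ℂ X.carrier := .ofCore (CStarModule.normedSpaceCore A)

lemma norm_sq_eq (x : X.carrier) : ‖x‖ ^ 2 = ‖X.linner x x‖ := CStarModule.norm_sq_eq A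

lemma norm_linner_le (x y : X.carrier) : ‖X.linner x y‖ ≤ ‖y‖ * ‖x‖ :=
  CStarModule.norm_inner_le (A := A) X.carrier (x := y) (y := x)

lemma linner_lact_right (a : A) (x y : X.carrier) :
    X.linner x (X.lact a y) = X.linner x y * star a := by
  rw [← X.star_linner, X.linner_lact, star_mul, X.star_linner]

lemma norm_lact_le (a : A) (x : X.carrier) : ‖X.lact a x‖ ≤ ‖a‖ * ‖x‖ := by
  refine (pow_le_pow_iff_left₀ (norm_nonneg _) (by positivity) two_ne_zero).mp ?_
  rw [mul_pow, X.norm_sq_eq, X.norm_sq_eq, X.linner_lact, X.linner_lact_right, ← mul_assoc]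
  calc ‖a * X.linner x x * star a‖ ≤ ‖a‖ * ‖X.linner x x‖ * ‖star a‖ :=
        norm_mul₃_le
    _ = ‖a‖ ^ 2 * ‖X.linner x x‖ := by rw [norm_star]; ring

/-- The C*-identity turns the order bound into `‖c‖² ≤ r ‖c‖`. -/
lemma norm_le_of_mul_self_le {C : Type*} [CStarAlgebra C] [PartialOrder C] [StarOrderedRing C]
    {c : C} {r : ℝ} (hc : 0 ≤ c) (hr : 0 ≤ r) (h : c * c ≤ r • c) : ‖c‖ ≤ r := by
  have hsa : star c = c := (IsSelfAdjoint.of_nonneg hc).star_eq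
  have h0 : 0 ≤ c * c := by
    have := star_mul_self_nonneg c
    rwa [hsa] at this
  have h1 := CStarAlgebra.norm_le_norm_of_nonneg_of_le h0 h
  have h2 : ‖c * c‖ = ‖c‖ * ‖c‖ := by
    have := CStarRing.norm_star_mul_self (x := c)
    rwa [hsa] at this
  rw [h2, norm_smul, Real.norm_of_nonneg hr] at h1
  rcases (norm_nonneg c).eq_or_lt with h3 | h3
  · rwa [← h3]
  · exact le_of_mul_le_mul_right h1 h3

/-- The defect `‖c‖ - c` is positive, hence of the form `d* d`. Writing it so turns norm estimates
into identities between sums of squares. -/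
lemma exists_star_mul_self_add {C : Type*} [CStarAlgebra C] [PartialOrder C] [StarOrderedRing C]
    {c : C} (hc : 0 ≤ c) : ∃ d : C, c + star d * d = ‖c‖ • (1 : C) := by
  have h : c ≤ algebraMap ℝ C ‖c‖ := (IsSelfAdjoint.of_nonneg hc).le_algebraMap_norm_self
  obtain ⟨d, hd⟩ := CStarAlgebra.nonneg_iff_eq_star_mul_self.mp (sub_nonneg.mpr h)
  refine ⟨d, ?_⟩
  rw [← hd, add_sub_cancel, Algebra.algebraMap_eq_smul_one]

/-- With `c = ⟨x, x⟩_A`, the compatibility of the inner products gives `c² = ⟨x·⟨x, x⟩_B, x⟩_A`.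
Adding the square of `x·d*` replaces `⟨x, x⟩_B` by its norm, so `c² ≤ ‖⟨x, x⟩_B‖ c`. -/
lemma norm_linner_le_norm_rinner (x : X.carrier) : ‖X.linner x x‖ ≤ ‖X.rinner x x‖ := by
  obtain ⟨d, hd⟩ := exists_star_mul_self_add (X.rinner_self_nonneg x)
  refine norm_le_of_mul_self_le (X.linner_self_nonneg x) (norm_nonneg _) ?_
  have h : X.linner x x * X.linner x x +
      X.linner (X.ract x (star d)) (X.ract x (star d)) = ‖X.rinner x x‖ • X.linner x x := by
    rw [← X.linner_lact, X.lact_linner, ← star_star d, ← X.linner_ract, ← X.ract_mul, star_star,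
      ← LinearMap.add_apply, ← map_add, ← map_add, star_star, hd]
    rw [show ‖X.rinner x x‖ • (1 : B) = (‖X.rinner x x‖ : ℂ) • (1 : B) by simp, map_smul,
      X.ract_one]
    simp
  rw [← h]
  exact le_add_of_nonneg_right (X.linner_self_nonneg _)

lemma norm_rinner_le_norm_linner (x : X.carrier) : ‖X.rinner x x‖ ≤ ‖X.linner x x‖ := by
  obtain ⟨d, hd⟩ := exists_star_mul_self_add (X.linner_self_nonneg x)
  have lact_one : X.lact 1 x = x := by
    rw [← sub_eq_zero]
    apply X.linner_self_definite
    simp [X.linner_lact, X.linner_lact_right]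
  refine norm_le_of_mul_self_le (X.rinner_self_nonneg x) (norm_nonneg _) ?_
  have h : X.rinner x x * X.rinner x x +
      X.rinner (X.lact d x) (X.lact d x) = ‖X.linner x x‖ • X.rinner x x := by
    rw [← X.rinner_ract, ← X.lact_linner, X.rinner_lact, ← X.lact_mul,
      ← map_add, ← LinearMap.add_apply, ← map_add, hd]
    rw [show ‖X.linner x x‖ • (1 : A) = (‖X.linner x x‖ : ℂ) • (1 : A) by simp, map_smul,
      LinearMap.smul_apply, lact_one]
    simp
  rw [← h]
  exact le_add_of_nonneg_right (X.rinner_self_nonneg _)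

/-- The left inner product against a fixed vector, as a continuous map. -/
noncomputable def linnerRight (y : X.carrier) : X.carrier →L[ℂ] A :=
  LinearMap.mkContinuous (X.linner.flip y) ‖y‖ fun x => X.norm_linner_le x y

/-- The left action on a fixed vector, as a continuous map. -/
noncomputable def lactRight (y : X.carrier) : A →L[ℂ] X.carrier :=
  LinearMap.mkContinuous (X.lact.flip y) ‖y‖ fun a =>
    (X.norm_lact_le a y).trans_eq (mul_comm _ _)

instance : CompleteSpace X.carrier := by
  -- The frame coefficients of a Cauchy sequence converge in the complete algebra `A`, and a vector
  -- depends continuously on its finitely many coefficients.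
  obtain ⟨n, f, hf⟩ := X.rinner_frame
  have recon (z : X.carrier) : ∑ i, X.lactRight (f i) (X.linnerRight (f i) z) = z := by
    change ∑ i, X.lact (X.linner z (f i)) (f i) = z
    simp_rw [X.lact_linner, ← map_sum, hf, X.ract_one]
  refine Metric.complete_of_cauchySeq_tendsto fun v hv => ?_
  have h (i : Fin n) : ∃ a, Filter.Tendsto (fun k => X.linnerRight (f i) (v k)) .atTop (nhds a) :=
    cauchySeq_tendsto_of_complete ((X.linnerRight (f i)).uniformContinuous.comp_cauchySeq hv)
  choose a ha using h
  refine ⟨∑ i, X.lactRight (f i) (a i), ?_⟩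
  have := tendsto_finsetSum Finset.univ fun i _ =>
    ((X.lactRight (f i)).continuous.tendsto (a i)).comp (ha i)
  simpa only [Function.comp_def, recon] using this

/-- The equivalence bimodule with given algebraic data. -/
noncomputable def toEquivalenceBimodule : EquivalenceBimodule A B where
  carrier := X.carrier
  lact := X.lact
  ract := X.ract
  linner := X.linner
  rinner := X.rinner
  lact_mul := X.lact_mul
  ract_mul := X.ract_mul
  lact_ract := X.lact_ract
  star_linner := X.star_linner
  star_rinner := X.star_rinner
  linner_lact := X.linner_lact
  rinner_ract := X.rinner_ract
  linner_self_nonneg := X.linner_self_nonneg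
  rinner_self_nonneg := X.rinner_self_nonneg
  norm_sq_eq_norm_linner := X.norm_sq_eq
  norm_sq_eq_norm_rinner x := (X.norm_sq_eq x).trans
    ((X.norm_linner_le_norm_rinner x).antisymm (X.norm_rinner_le_norm_linner x))
  linner_ract := X.linner_ract
  rinner_lact := X.rinner_lact
  lact_linner := X.lact_linner
  linner_full := by
    rw [eq_top_iff]
    refine fun a _ => Submodule.le_topologicalClosure _ ?_
    obtain ⟨n, f, hf⟩ := X.linner_frame
    rw [← mul_one a, ← hf, Finset.mul_sum]
    refine Submodule.sum_mem _ fun i _ => Submodule.subset_span ⟨X.lact a (f i), f i, ?_⟩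
    rw [X.linner_lact]
  rinner_full := by
    rw [eq_top_iff]
    refine fun b _ => Submodule.le_topologicalClosure _ ?_
    obtain ⟨n, f, hf⟩ := X.rinner_frame
    rw [← one_mul b, ← hf, Finset.sum_mul]
    refine Submodule.sum_mem _ fun i _ => Submodule.subset_span ⟨f i, X.ract (f i) b, ?_⟩
    rw [X.rinner_ract]

end AlgebraicBimodule

end CStarMorita

/-! ### The interior tensor product -/

namespace CStarMorita

namespace EquivalenceBimodule

variable {A B C : Type u}
  [CStarAlgebra A] [PartialOrder A] [StarOrderedRing A]
  [CStarAlgebra B] [PartialOrder B] [StarOrderedRing B]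
  [CStarAlgebra C] [PartialOrder C] [StarOrderedRing C]
  (X : EquivalenceBimodule A B) (Y : EquivalenceBimodule B C)

/-- The carrier of the interior tensor product `X ⊗_B Y` for unital algebras: the conjugate-linear
maps `T : Y → X` with `T (b • y) = T y • b*`. The elementary tensor `x ⊗ y` corresponds to
`y' ↦ x • ⟨y, y'⟩_B`. -/
def tensorSubmodule : Submodule ℂ (Y.carrier →ₗ⋆[ℂ] X.carrier) where
  carrier := {T | ∀ (b : B) (y : Y.carrier), T (Y.lact b y) = X.ract (T y) (star b)}
  add_mem' {S T} hS hT b y := by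
    simp only [Set.mem_ofPred_eq] at hS hT
    simp [hS, hT]
  zero_mem' b y := by simp
  smul_mem' c T hT b y := by
    simp only [Set.mem_ofPred_eq] at hT
    simp [hT]

variable {X Y}

lemma tensorSubmodule_apply_lact (T : tensorSubmodule X Y) (b : B) (y : Y.carrier) :
    T.1 (Y.lact b y) = X.ract (T.1 y) (star b) := T.2 b y

/-- Reconstruction of a vector from its left coefficients along a right Parseval frame. -/
lemma sum_lact_linner {n : ℕ} {w : Fin n → Y.carrier} (hw : ∑ i, Y.rinner (w i) (w i) = 1)
    (y : Y.carrier) : ∑ i, Y.lact (Y.linner y (w i)) (w i) = y := by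
  simp_rw [Y.lact_linner, ← map_sum, hw, Y.ract_one]

/-- Twisted linearity applied to the frame expansion of `y`: a tensor is determined by its values on
the frame. -/
lemma tensorSubmodule_apply_eq_sum {n : ℕ} {w : Fin n → Y.carrier}
    (hw : ∑ i, Y.rinner (w i) (w i) = 1) (T : tensorSubmodule X Y) (y : Y.carrier) :
    T.1 y = ∑ i, X.ract (T.1 (w i)) (Y.linner (w i) y) := by
  conv_lhs => rw [← sum_lact_linner hw y, map_sum]
  simp_rw [tensorSubmodule_apply_lact, Y.star_linner]

/-- Elementary tensors. -/
noncomputable def tmul (x : X.carrier) (y : Y.carrier) : tensorSubmodule X Y :=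
  ⟨(X.ract x).comp (Y.linner y), fun b y' => by simp [Y.linner_lact_right, X.ract_mul]⟩

@[simp] lemma tmul_apply (x : X.carrier) (y y' : Y.carrier) :
    (tmul x y).1 y' = X.ract x (Y.linner y y') := rfl

/-- The left action on the tensor product. -/
noncomputable def tensorLact : A →ₗ[ℂ] tensorSubmodule X Y →ₗ[ℂ] tensorSubmodule X Y :=
  LinearMap.mk₂ ℂ
    (fun a T => ⟨(X.lact a).comp T.1, fun b y => by
      simp [tensorSubmodule_apply_lact, X.lact_ract]⟩)
    (fun _ _ _ => by ext; simp) (fun _ _ _ => by ext; simp)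
    (fun _ _ _ => by ext; simp) (fun _ _ _ => by ext; simp)

@[simp] lemma tensorLact_apply (a : A) (T : tensorSubmodule X Y) (y : Y.carrier) :
    (tensorLact a T).1 y = X.lact a (T.1 y) := rfl

/-- The right action on the tensor product. -/
noncomputable def tensorRact : tensorSubmodule X Y →ₗ[ℂ] C →ₗ[ℂ] tensorSubmodule X Y :=
  LinearMap.mk₂ ℂ
    (fun T c => ⟨T.1.comp (Y.ract.flip (star c)), fun b y => by
      simp [tensorSubmodule_apply_lact, ← Y.lact_ract]⟩)
    (fun _ _ _ => by ext; simp) (fun _ _ _ => by ext; simp)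
    (fun _ _ _ => by ext; simp) (fun _ _ _ => by ext; simp)

@[simp] lemma tensorRact_apply (T : tensorSubmodule X Y) (c : C) (y : Y.carrier) :
    (tensorRact T c).1 y = T.1 (Y.ract y (star c)) := rfl

variable {n : ℕ} (w : Fin n → Y.carrier)

/-- The left inner product on the tensor product, computed in a right Parseval frame. -/
noncomputable def tensorLinner : tensorSubmodule X Y →ₗ[ℂ] tensorSubmodule X Y →ₗ⋆[ℂ] A :=
  LinearMap.mk₂'ₛₗ (RingHom.id ℂ) (starRingEnd ℂ)
    (fun T S => ∑ j, X.linner (T.1 (w j)) (S.1 (w j)))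
    (by simp [Finset.sum_add_distrib]) (by simp [Finset.smul_sum])
    (by simp [Finset.sum_add_distrib]) (by simp [Finset.smul_sum])

lemma tensorLinner_apply (T S : tensorSubmodule X Y) :
    tensorLinner w T S = ∑ j, X.linner (T.1 (w j)) (S.1 (w j)) := rfl

/-- The right inner product on the tensor product, computed in a right Parseval frame. -/
noncomputable def tensorRinner : tensorSubmodule X Y →ₗ⋆[ℂ] tensorSubmodule X Y →ₗ[ℂ] C :=
  LinearMap.mk₂'ₛₗ (starRingEnd ℂ) (RingHom.id ℂ)
    (fun T S => ∑ i, ∑ j, Y.rinner (w i) (Y.lact (X.rinner (T.1 (w i)) (S.1 (w j))) (w j)))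
    (by simp [Finset.sum_add_distrib]) (by simp [Finset.smul_sum])
    (by simp [Finset.sum_add_distrib]) (by simp [Finset.smul_sum])

lemma tensorRinner_apply (T S : tensorSubmodule X Y) :
    tensorRinner w T S =
      ∑ i, ∑ j, Y.rinner (w i) (Y.lact (X.rinner (T.1 (w i)) (S.1 (w j))) (w j)) := rfl

variable {w} (hw : ∑ i, Y.rinner (w i) (w i) = 1)

include hw

/-- Expand `T` along the frame and move the `B`-valued coefficients to the other slot; the remaining
sum reassembles `S`. -/
lemma tensorLinner_tensorRact (T S : tensorSubmodule X Y) (c : C) :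
    tensorLinner w (tensorRact T c) S = tensorLinner w T (tensorRact S (star c)) := by
  simp only [tensorLinner_apply, tensorRact_apply, star_star]
  calc ∑ j, X.linner (T.1 (Y.ract (w j) (star c))) (S.1 (w j))
      = ∑ j, ∑ k, X.linner (X.ract (T.1 (w k)) (Y.linner (w k) (Y.ract (w j) (star c))))
          (S.1 (w j)) := by
        refine Finset.sum_congr rfl fun j _ => ?_
        rw [tensorSubmodule_apply_eq_sum hw T]
        simp
    _ = ∑ k, ∑ j, X.linner (T.1 (w k)) (X.ract (S.1 (w j)) (Y.linner (w j) (Y.ract (w k) c))) := by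
        rw [Finset.sum_comm]
        refine Finset.sum_congr rfl fun k _ => Finset.sum_congr rfl fun j _ => ?_
        rw [X.linner_ract, Y.star_linner, Y.linner_ract, star_star]
    _ = _ := by
        refine Finset.sum_congr rfl fun k _ => ?_
        rw [tensorSubmodule_apply_eq_sum hw S (Y.ract (w k) c)]
        simp

lemma tensorRinner_tensorRact (T S : tensorSubmodule X Y) (c : C) :
    tensorRinner w T (tensorRact S c) = tensorRinner w T S * c := by
  simp only [tensorRinner_apply, tensorRact_apply, Finset.sum_mul]
  refine Finset.sum_congr rfl fun i _ => ?_
  calc ∑ j, Y.rinner (w i) (Y.lact (X.rinner (T.1 (w i)) (S.1 (Y.ract (w j) (star c)))) (w j))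
      = ∑ j, ∑ k, Y.rinner (w i) (Y.lact (X.rinner (T.1 (w i)) (S.1 (w k)))
          (Y.lact (Y.linner (Y.ract (w k) c) (w j)) (w j))) := by
        refine Finset.sum_congr rfl fun j _ => ?_
        rw [tensorSubmodule_apply_eq_sum hw S]
        simp [X.rinner_ract, Y.lact_mul, Y.linner_ract]
    _ = _ := by
        rw [Finset.sum_comm]
        refine Finset.sum_congr rfl fun k _ => ?_
        rw [← map_sum, ← map_sum, sum_lact_linner hw, Y.lact_ract, Y.rinner_ract]

lemma tensorLact_tensorLinner (T S R : tensorSubmodule X Y) :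
    tensorLact (tensorLinner w T S) R = tensorRact T (tensorRinner w S R) := by
  ext y
  simp only [tensorLact_apply, tensorRact_apply, tensorLinner_apply, tensorRinner_apply]
  rw [tensorSubmodule_apply_eq_sum hw R y]
  simp only [map_sum, LinearMap.sum_apply, star_sum]
  rw [Finset.sum_comm]
  refine Finset.sum_congr rfl fun j _ => Finset.sum_congr rfl fun i _ => ?_
  rw [Y.star_rinner, Y.rinner_lact, ← Y.lact_linner, tensorSubmodule_apply_lact,
    tensorSubmodule_apply_lact, Y.star_linner, star_star, X.lact_ract, X.lact_linner]

/-- On elementary tensors the frame disappears. This makes products of Parseval frames into Parseval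
frames of the tensor product. -/
lemma tensorLinner_tmul (x x' : X.carrier) (y y' : Y.carrier) :
    tensorLinner w (tmul x y) (tmul x' y') = X.linner (X.ract x (Y.linner y y')) x' := by
  simp only [tensorLinner_apply, tmul_apply]
  conv_rhs => rw [← sum_lact_linner hw y]
  simp [X.linner_ract, ← X.ract_mul, Y.linner_lact, Y.star_linner]

lemma tensorRinner_tmul (x x' : X.carrier) (y y' : Y.carrier) :
    tensorRinner w (tmul x y) (tmul x' y') = Y.rinner y (Y.lact (X.rinner x x') y') := by
  simp only [tensorRinner_apply, tmul_apply]
  conv_rhs => rw [← sum_lact_linner hw y, ← sum_lact_linner hw y']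
  simp only [map_sum, LinearMap.sum_apply]
  rw [Finset.sum_comm]
  refine Finset.sum_congr rfl fun i _ => Finset.sum_congr rfl fun j _ => ?_
  simp [X.rinner_ract, X.rinner_ract_left, Y.rinner_lact, ← Y.lact_mul, mul_assoc]

omit hw in
lemma star_tensorLinner (T S : tensorSubmodule X Y) :
    star (tensorLinner w T S) = tensorLinner w S T := by
  simp [tensorLinner_apply, X.star_linner]

omit hw in
lemma star_tensorRinner (T S : tensorSubmodule X Y) :
    star (tensorRinner w T S) = tensorRinner w S T := by
  simp only [tensorRinner_apply, star_sum]
  rw [Finset.sum_comm]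
  simp [Y.star_rinner, X.star_rinner, Y.rinner_lact]

-- A left frame `f` of `X` factors its right inner product as `⟨x, x'⟩ = ∑ ⟨x, f k⟩⟨f k, x'⟩`, which
-- exhibits the double sum as a sum of squares in `Y`.
omit hw in
lemma tensorRinner_self_nonneg (T : tensorSubmodule X Y) : 0 ≤ tensorRinner w T T := by
  obtain ⟨m, f, hf⟩ := X.exists_linner_frame
  have h (x x' : X.carrier) : X.rinner x x' = ∑ k, X.rinner x (f k) * X.rinner (f k) x' := by
    conv_lhs => rw [← X.lact_one x', ← hf]
    simp [X.lact_linner, X.rinner_ract]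
  have : tensorRinner w T T = ∑ k, Y.rinner (∑ i, Y.lact (X.rinner (f k) (T.1 (w i))) (w i))
      (∑ i, Y.lact (X.rinner (f k) (T.1 (w i))) (w i)) := by
    have h' (i j : Fin n) : Y.rinner (w i) (Y.lact (X.rinner (T.1 (w i)) (T.1 (w j))) (w j)) =
        ∑ k, Y.rinner (Y.lact (X.rinner (f k) (T.1 (w i))) (w i))
          (Y.lact (X.rinner (f k) (T.1 (w j))) (w j)) := by
      rw [h]
      simp [Y.rinner_lact, X.star_rinner, Y.lact_mul]
    simp only [tensorRinner_apply, h']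
    rw [Finset.sum_comm_cycle]
    refine Finset.sum_congr rfl fun k _ => ?_
    rw [Finset.sum_comm]
    simp
  rw [this]
  exact Finset.sum_nonneg fun k _ => Y.rinner_self_nonneg _

omit hw in
lemma tensorLinner_self_nonneg (T : tensorSubmodule X Y) : 0 ≤ tensorLinner w T T := by
  rw [tensorLinner_apply]
  exact Finset.sum_nonneg fun _ _ => X.linner_self_nonneg _

lemma eq_zero_of_tensorLinner_self (T : tensorSubmodule X Y) (h : tensorLinner w T T = 0) :
    T = 0 := by
  rw [tensorLinner_apply,
    Finset.sum_eq_zero_iff_of_nonneg fun _ _ => X.linner_self_nonneg _] at h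
  ext y
  rw [tensorSubmodule_apply_eq_sum hw T y]
  refine Finset.sum_eq_zero fun i hi => ?_
  rw [X.eq_zero_of_linner_self (h i hi), map_zero, LinearMap.zero_apply]

/-- The algebraic data of the tensor product bimodule. -/
noncomputable def algebraicTensor : AlgebraicBimodule A C where
  carrier := tensorSubmodule X Y
  lact := tensorLact
  ract := tensorRact
  linner := tensorLinner w
  rinner := tensorRinner w
  lact_mul a a' T := by ext y; simp [X.lact_mul]
  ract_mul T c c' := by ext y; simp [Y.ract_mul]
  ract_one T := by ext y; simp [Y.ract_one]
  lact_ract a T c := rfl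
  star_linner := star_tensorLinner
  star_rinner := star_tensorRinner
  linner_lact a T S := by simp [tensorLinner_apply, X.linner_lact, Finset.mul_sum]
  rinner_ract := tensorRinner_tensorRact hw
  linner_self_nonneg := tensorLinner_self_nonneg
  rinner_self_nonneg := tensorRinner_self_nonneg
  linner_self_definite := eq_zero_of_tensorLinner_self hw
  linner_ract := tensorLinner_tensorRact hw
  rinner_lact a T S := by simp [tensorRinner_apply, X.rinner_lact]
  lact_linner := tensorLact_tensorLinner hw
  linner_frame := by
    obtain ⟨m, f, hf⟩ := X.exists_linner_frame
    obtain ⟨l, g, hg⟩ := Y.exists_linner_frame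
    refine ⟨m * l, fun k => tmul (f (finProdFinEquiv.symm k).1) (g (finProdFinEquiv.symm k).2), ?_⟩
    rw [Equiv.sum_comp finProdFinEquiv.symm
      (fun p => tensorLinner w (tmul (f p.1) (g p.2)) (tmul (f p.1) (g p.2))),
      Fintype.sum_prod_type]
    simp_rw [tensorLinner_tmul hw, ← LinearMap.sum_apply, ← map_sum, hg, X.ract_one, hf]
  rinner_frame := by
    obtain ⟨m, f, hf⟩ := X.exists_rinner_frame
    obtain ⟨l, g, hg⟩ := Y.exists_rinner_frame
    refine ⟨m * l, fun k => tmul (f (finProdFinEquiv.symm k).1) (g (finProdFinEquiv.symm k).2), ?_⟩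
    rw [Equiv.sum_comp finProdFinEquiv.symm
      (fun p => tensorRinner w (tmul (f p.1) (g p.2)) (tmul (f p.1) (g p.2))),
      Fintype.sum_prod_type_right]
    simp_rw [tensorRinner_tmul hw, ← map_sum, ← LinearMap.sum_apply, ← map_sum, hf, Y.lact_one, hg]

end EquivalenceBimodule

end CStarMorita

/-! ### Transitivity for representations, and induction along a bimodule -/

namespace CStarMorita

open ContinuousLinearMap (adjoint)

variable {A B C : Type u}
  [CStarAlgebra A] [PartialOrder A] [StarOrderedRing A]
  [CStarAlgebra B] [PartialOrder B] [StarOrderedRing B]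
  [CStarAlgebra C] [PartialOrder C] [StarOrderedRing C]
  {H K L : Type u}
  [NormedAddCommGroup H] [InnerProductSpace ℂ H] [CompleteSpace H]
  [NormedAddCommGroup K] [InnerProductSpace ℂ K] [CompleteSpace K]
  [NormedAddCommGroup L] [InnerProductSpace ℂ L] [CompleteSpace L]

omit [PartialOrder A] [StarOrderedRing A] in
lemma IsNondegenerate.of_map_one {π : A →⋆ₙₐ[ℂ] (H →L[ℂ] H)} (h : π 1 = 1) :
    IsNondegenerate π := by
  rw [IsNondegenerate, eq_top_iff]
  refine fun v _ => Submodule.le_topologicalClosure _ (Submodule.subset_span ⟨1, v, ?_⟩)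
  rw [h, one_apply_eq_self]

namespace IsBimoduleRepresentation

variable {X : EquivalenceBimodule A B} {πA : A →⋆ₙₐ[ℂ] (H →L[ℂ] H)}
  {πX : X.carrier →ₗ[ℂ] (K →L[ℂ] H)} {πB : B →⋆ₙₐ[ℂ] (K →L[ℂ] K)}
  (h : IsBimoduleRepresentation X πA πX πB)

include h

lemma comp_adjoint_apply (x y : X.carrier) (v : H) :
    πX x (adjoint (πX y) v) = πA (X.linner x y) v := by
  rw [← h.comp_adjoint]; rfl

lemma adjoint_comp_apply (x y : X.carrier) (v : K) :
    adjoint (πX x) (πX y v) = πB (X.rinner x y) v := by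
  rw [← h.adjoint_comp]; rfl

lemma map_lact_apply (a : A) (x : X.carrier) (v : K) : πX (X.lact a x) v = πA a (πX x v) := by
  have := h.map_act a x 1
  rw [X.ract_one, h.nondegenerate_right.map_one] at this
  rw [this]; rfl

lemma map_ract_apply (x : X.carrier) (b : B) (v : K) : πX (X.ract x b) v = πX x (πB b v) := by
  have := h.map_act 1 x b
  rw [X.lact_one, h.nondegenerate_left.map_one] at this
  rw [this]; rfl

end IsBimoduleRepresentation

lemma RepStronglyMoritaEquivalent.trans {πA : A →⋆ₙₐ[ℂ] (H →L[ℂ] H)}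
    {πB : B →⋆ₙₐ[ℂ] (K →L[ℂ] K)} {πC : C →⋆ₙₐ[ℂ] (L →L[ℂ] L)}
    (h : RepStronglyMoritaEquivalent πA πB) (h' : RepStronglyMoritaEquivalent πB πC) :
    RepStronglyMoritaEquivalent πA πC := by
  obtain ⟨X, πX, hX⟩ := h
  obtain ⟨Y, πY, hY⟩ := h'
  obtain ⟨n, w, hw⟩ := Y.exists_rinner_frame
  let Z := EquivalenceBimodule.algebraicTensor (X := X) (Y := Y) hw
  -- On `x ⊗ y` this is `πX(x) πY(y)`, by the frame expansion of `y`.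
  let πZ : X.tensorSubmodule Y →ₗ[ℂ] (L →L[ℂ] H) :=
    { toFun := fun T => ∑ j, πX (T.1 (w j)) ∘L πY (w j)
      map_add' := fun S T => by ext v; simp [Finset.sum_add_distrib]
      map_smul' := fun c T => by ext v; simp [Finset.smul_sum] }
  have hZ (T : X.tensorSubmodule Y) (v : L) : πZ T v = ∑ j, πX (T.1 (w j)) (πY (w j) v) := by
    simp [πZ]
  have hZ' (T : X.tensorSubmodule Y) (v : H) :
      adjoint (πZ T) v = ∑ j, adjoint (πY (w j)) (adjoint (πX (T.1 (w j))) v) := by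
    simp [πZ, ContinuousLinearMap.adjoint_comp]
  have hsum (T : X.tensorSubmodule Y) (y : Y.carrier) (u : K) :
      πX (T.1 y) u = ∑ k, πX (X.ract (T.1 (w k)) (Y.linner (w k) y)) u := by
    rw [EquivalenceBimodule.tensorSubmodule_apply_eq_sum hw T y]
    simp
  have hZl (T S : X.tensorSubmodule Y) :
      πZ T ∘L adjoint (πZ S) = πA (EquivalenceBimodule.tensorLinner w T S) := by
    ext v
    rw [ContinuousLinearMap.comp_apply, hZ, hZ']
    simp only [map_sum, hY.comp_adjoint_apply, ← hX.map_ract_apply]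
    rw [Finset.sum_comm]
    simp only [← hsum]
    simp only [hX.comp_adjoint_apply, EquivalenceBimodule.tensorLinner_apply, map_sum,
      sum_apply]
  have hZr (T S : X.tensorSubmodule Y) :
      adjoint (πZ T) ∘L πZ S = πC (EquivalenceBimodule.tensorRinner w T S) := by
    ext v
    rw [ContinuousLinearMap.comp_apply, hZ, hZ']
    simp only [map_sum, hX.adjoint_comp_apply, ← hY.map_lact_apply, hY.adjoint_comp_apply,
      EquivalenceBimodule.tensorRinner_apply, sum_apply]
  have hZm (a : A) (T : X.tensorSubmodule Y) (c : C) :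
      πZ (EquivalenceBimodule.tensorRact (EquivalenceBimodule.tensorLact a T) c) =
        πA a ∘L πZ T ∘L πC c := by
    ext v
    simp only [ContinuousLinearMap.comp_apply, hZ, EquivalenceBimodule.tensorRact_apply,
      EquivalenceBimodule.tensorLact_apply, hX.map_lact_apply, ← map_sum]
    congr 1
    calc ∑ j, πX (T.1 (Y.ract (w j) (star c))) (πY (w j) v)
        = ∑ j, ∑ k, πX (T.1 (w k))
            (πY (Y.lact (Y.linner (Y.ract (w k) c) (w j)) (w j)) v) := by
          refine Finset.sum_congr rfl fun j _ => ?_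
          rw [hsum]
          simp only [hX.map_ract_apply, hY.map_lact_apply, Y.linner_ract]
      _ = ∑ k, πX (T.1 (w k)) (πY (w k) (πC c v)) := by
          rw [Finset.sum_comm]
          refine Finset.sum_congr rfl fun k _ => ?_
          rw [← map_sum, ← sum_apply, ← map_sum,
            EquivalenceBimodule.sum_lact_linner hw, hY.map_ract_apply]
  exact ⟨Z.toEquivalenceBimodule, πZ, hX.nondegenerate_left, hY.nondegenerate_right,
    hZl, hZr, hZm⟩

/-- Conjugating the right-hand representation by a unitary preserves strong Morita equivalence. -/
lemma RepStronglyMoritaEquivalent.of_unitary_right {πA : A →⋆ₙₐ[ℂ] (H →L[ℂ] H)}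
    {πB : B →⋆ₙₐ[ℂ] (K →L[ℂ] K)} {πB' : B →⋆ₙₐ[ℂ] (L →L[ℂ] L)}
    (h : RepStronglyMoritaEquivalent πA πB) (U : K →L[ℂ] L)
    (hU : adjoint U ∘L U = 1) (hU' : U ∘L adjoint U = 1)
    (hπ : ∀ b, U ∘L πB b = πB' b ∘L U) : RepStronglyMoritaEquivalent πA πB' := by
  obtain ⟨X, πX, hX⟩ := h
  have hπ' (b : B) : πB' b = U ∘L πB b ∘L adjoint U := by
    rw [← ContinuousLinearMap.comp_assoc, hπ, ContinuousLinearMap.comp_assoc, hU']; rfl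
  have hUv (v : K) : adjoint U (U v) = v := congr($hU v)
  have hUv' (v : L) : U (adjoint U v) = v := congr($hU' v)
  refine ⟨X, { toFun := fun x => πX x ∘L adjoint U, map_add' := ?_, map_smul' := ?_ },
    hX.nondegenerate_left, .of_map_one ?_, ?_, ?_, ?_⟩
  · intro x y; ext v; simp
  · intro c x; ext v; simp
  · rw [hπ', hX.nondegenerate_right.map_one]; exact hU'
  · intro x y
    ext v
    simp [ContinuousLinearMap.adjoint_comp, hUv, hX.comp_adjoint_apply]
  · intro x y
    ext v
    simp [ContinuousLinearMap.adjoint_comp, hπ', hX.adjoint_comp_apply]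
  · intro a x b
    ext v
    simp [hπ', hUv, hX.map_act]

/-- A family of operators `R x : E → H` with `R x (R y)* = πA ⟨x, y⟩_A` that is compatible with the
left action becomes a representation of the bimodule on a closed subspace of `E`. -/
lemma exists_repStronglyMoritaEquivalent_of_rows {E : Type u}
    [NormedAddCommGroup E] [InnerProductSpace ℂ E] [CompleteSpace E]
    (X : EquivalenceBimodule A B) (πA : A →⋆ₙₐ[ℂ] (H →L[ℂ] H)) (hA : IsNondegenerate πA)
    (R : X.carrier →ₗ[ℂ] (E →L[ℂ] H))
    (hRR : ∀ x y, R x ∘L adjoint (R y) = πA (X.linner x y))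
    (hRl : ∀ a x, R (X.lact a x) = πA a ∘L R x) :
    ∃ (K : Type u) (_ : NormedAddCommGroup K) (_ : InnerProductSpace ℂ K) (_ : CompleteSpace K)
      (πB : B →⋆ₙₐ[ℂ] (K →L[ℂ] K)), RepStronglyMoritaEquivalent πA πB := by
  obtain ⟨n, f, hf⟩ := X.exists_rinner_frame
  have recon (x : X.carrier) : ∑ j, X.lact (X.linner x (f j)) (f j) = x :=
    EquivalenceBimodule.sum_lact_linner hf x
  have hRR' (x y : X.carrier) (v : H) : R x (adjoint (R y) v) = πA (X.linner x y) v := by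
    rw [← hRR]; rfl
  have hRl' (a : A) (x : X.carrier) (v : E) : R (X.lact a x) v = πA a (R x v) := by
    rw [hRl]; rfl
  have hRa (a : A) (x : X.carrier) (v : H) :
      adjoint (R x) (πA a v) = adjoint (R (X.lact (star a) x)) v := by
    rw [hRl, ContinuousLinearMap.adjoint_comp, map_star, ContinuousLinearMap.star_eq_adjoint,
      ContinuousLinearMap.adjoint_adjoint]
    rfl
  -- The formula is forced by `R(x)* R(y) = ρ⟨x, y⟩`, because `b = ∑ ⟨f k, f k · b⟩`.
  let ρ : B →ₗ[ℂ] (E →L[ℂ] E) :=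
    { toFun := fun b => ∑ k, adjoint (R (f k)) ∘L R (X.ract (f k) b)
      map_add' := fun x y => by ext v; simp [Finset.sum_add_distrib]
      map_smul' := fun c x => by ext v; simp [Finset.smul_sum] }
  have hρ (b : B) (v : E) : ρ b v = ∑ k, adjoint (R (f k)) (R (X.ract (f k) b) v) := by simp [ρ]
  have hρin (x y : X.carrier) : adjoint (R x) ∘L R y = ρ (X.rinner x y) := by
    ext v
    simp only [ContinuousLinearMap.comp_apply, hρ, ← X.lact_linner, hRl', hRa, X.star_linner]
    conv_lhs => rw [← recon x]
    simp
  have hRρ (x : X.carrier) (b : B) (v : E) : R x (ρ b v) = R (X.ract x b) v := by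
    simp only [hρ, map_sum, hRR']
    conv_rhs => rw [← recon x]
    simp [← X.lact_ract, hRl']
  have hρmul (b c : B) : ρ (b * c) = ρ b * ρ c := by
    ext v
    rw [mul_apply_eq_comp, hρ, hρ]
    simp [hRρ, X.ract_mul]
  have hρstar (b : B) : star (ρ b) = ρ (star b) := by
    have : star (ρ b) = ∑ k, adjoint (R (X.ract (f k) b)) ∘L R (f k) := by
      simp only [ρ, LinearMap.coe_mk, AddHom.coe_mk, star_sum]
      refine Finset.sum_congr rfl fun k _ => ?_
      rw [ContinuousLinearMap.star_eq_adjoint, ContinuousLinearMap.adjoint_comp,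
        ContinuousLinearMap.adjoint_adjoint]
    rw [this]
    simp only [hρin, X.rinner_ract_left]
    rw [← map_sum, ← Finset.mul_sum, hf, mul_one]
  -- On all of `E`, `ρ` need not be unital. Compressing to the range of the projection `ρ 1` repairs
  -- this, and loses nothing because `R x ∘ ρ 1 = R x`.
  have hP : IsStarProjection (ρ 1) :=
    ⟨by rw [IsIdempotentElem, ← hρmul, one_mul], by rw [IsSelfAdjoint, hρstar, star_one]⟩
  let K : Submodule ℂ E := (ρ 1).range
  have hK : IsClosed (K : Set E) := ContinuousLinearMap.IsIdempotentElem.isClosed_range hP.1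
  have : CompleteSpace K := hK.completeSpace_coe
  have hJJ (v : E) : K.subtypeL (adjoint K.subtypeL v) = ρ 1 v := by
    obtain ⟨_, h⟩ := isStarProjection_iff_eq_starProjection_range.mp hP
    rw [Submodule.adjoint_subtypeL]
    conv_rhs => rw [h]
    rfl
  have hJ (v : K) : adjoint K.subtypeL (K.subtypeL v) = v := by
    rw [Submodule.adjoint_subtypeL]
    simp
  have hρ1 (b : B) (v : E) : ρ b (ρ 1 v) = ρ b v := by
    rw [← mul_apply_eq_comp, ← hρmul, mul_one]
  have hρ1' (v : K) : ρ 1 (K.subtypeL v) = K.subtypeL v := by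
    rw [← hJJ, hJ]
  have hR1 (x : X.carrier) (v : E) : R x (ρ 1 v) = R x v := by rw [hRρ, X.ract_one]
  let πB : B →⋆ₙₐ[ℂ] (K →L[ℂ] K) :=
    { toFun := fun b => adjoint K.subtypeL ∘L ρ b ∘L K.subtypeL
      map_smul' := fun c b => by ext v; simp
      map_zero' := by ext v; simp
      map_add' := fun b c => by ext v; simp
      map_mul' := fun b c => by
        ext1 v
        simp only [mul_apply_eq_comp, ContinuousLinearMap.comp_apply, hJJ, hρ1, hρmul]
      map_star' := fun b => by
        rw [← hρstar, ContinuousLinearMap.star_eq_adjoint, ContinuousLinearMap.star_eq_adjoint,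
          ContinuousLinearMap.adjoint_comp, ContinuousLinearMap.adjoint_comp,
          ContinuousLinearMap.adjoint_adjoint, ContinuousLinearMap.comp_assoc] }
  have hπB (b : B) (v : K) : πB b v = adjoint K.subtypeL (ρ b (K.subtypeL v)) := rfl
  let πX : X.carrier →ₗ[ℂ] (K →L[ℂ] H) :=
    { toFun := fun x => R x ∘L K.subtypeL
      map_add' := fun x y => by ext v; simp
      map_smul' := fun c x => by ext v; simp }
  have hπX (x : X.carrier) (v : K) : πX x v = R x (K.subtypeL v) := rfl
  have hπX' (x : X.carrier) (v : H) : adjoint (πX x) v = adjoint K.subtypeL (adjoint (R x) v) := by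
    change adjoint (R x ∘L K.subtypeL) v = _
    rw [ContinuousLinearMap.adjoint_comp]
    rfl
  refine ⟨K, inferInstance, inferInstance, inferInstance, πB, X, πX, hA, .of_map_one ?_, ?_, ?_, ?_⟩
  · ext1 v
    rw [hπB, hρ1', hJ]
    rfl
  · intro x y
    ext1 v
    rw [ContinuousLinearMap.comp_apply, hπX', hπX, hJJ, hR1, hRR']
  · intro x y
    ext1 v
    rw [ContinuousLinearMap.comp_apply, hπX', hπX, hπB, ← hρin]
    rfl
  · intro a x b
    ext1 v
    simp only [ContinuousLinearMap.comp_apply, hπX, hπB, hJJ, hR1, hRρ]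
    rw [← X.lact_ract, hRl']

/-- Every nondegenerate representation of `A` induces one of a strongly Morita equivalent
algebra `B`. -/
lemma exists_repStronglyMoritaEquivalent (X : EquivalenceBimodule A B)
    (πA : A →⋆ₙₐ[ℂ] (H →L[ℂ] H)) (hA : IsNondegenerate πA) :
    ∃ (K : Type u) (_ : NormedAddCommGroup K) (_ : InnerProductSpace ℂ K) (_ : CompleteSpace K)
      (πB : B →⋆ₙₐ[ℂ] (K →L[ℂ] K)), RepStronglyMoritaEquivalent πA πB := by
  classical
  obtain ⟨n, f, hf⟩ := X.exists_rinner_frame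
  have recon (x : X.carrier) : ∑ j, X.lact (X.linner x (f j)) (f j) = x :=
    EquivalenceBimodule.sum_lact_linner hf x
  let E := PiLp 2 (fun _ : Fin n => H)
  have hproj (j k : Fin n) (v : H) : PiLp.proj 2 (𝕜 := ℂ) (fun _ : Fin n => H) j
      (adjoint (PiLp.proj 2 (𝕜 := ℂ) (fun _ : Fin n => H) k) v) = if j = k then v else 0 := by
    have : adjoint (PiLp.proj 2 (𝕜 := ℂ) (fun _ : Fin n => H) k) v = PiLp.single 2 k v := by
      refine ext_inner_right ℂ fun z => ?_
      rw [ContinuousLinearMap.adjoint_inner_left, PiLp.inner_apply,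
        Finset.sum_eq_single k (fun i _ hi => by simp [hi]) (by simp)]
      simp
    rw [this]
    simp
  -- `R x` is the row of operators `πA⟨x, f j⟩`; then `R x (R y)*` is the image of `∑ ⟨x, f j⟩⟨f j,
  -- y⟩ = ⟨x, y⟩`.
  let R : X.carrier →ₗ[ℂ] (E →L[ℂ] H) :=
    { toFun := fun x => ∑ j, πA (X.linner x (f j)) ∘L PiLp.proj 2 (fun _ : Fin n => H) j
      map_add' := fun x y => by ext v; simp [Finset.sum_add_distrib]
      map_smul' := fun c x => by ext v; simp [Finset.smul_sum] }
  have hR (x : X.carrier) (v : E) :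
    R x v = ∑ j, πA (X.linner x (f j)) (PiLp.proj 2 (𝕜 := ℂ) (fun _ : Fin n => H) j v) := by simp [R]; rfl
  have hR' (x : X.carrier) (v : H) : adjoint (R x) v =
      ∑ j, adjoint (PiLp.proj 2 (𝕜 := ℂ) (fun _ : Fin n => H) j) (πA (X.linner (f j) x) v) := by
    simp only [R, LinearMap.coe_mk, AddHom.coe_mk, map_sum, ContinuousLinearMap.adjoint_comp,
      ← ContinuousLinearMap.star_eq_adjoint, ← map_star πA, X.star_linner]
    simp
  have hRR (x y : X.carrier) : R x ∘L adjoint (R y) = πA (X.linner x y) := by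
    ext v
    rw [ContinuousLinearMap.comp_apply, hR', hR]
    simp only [map_sum, hproj]
    have h (j : Fin n) : πA (X.linner x (f j)) (πA (X.linner (f j) y) v) =
        πA (X.linner (X.lact (X.linner x (f j)) (f j)) y) v := by
      rw [X.linner_lact, map_mul, mul_apply_eq_comp]
    conv_rhs => rw [← recon x]
    simp [← h, apply_ite]
  have hRl (a : A) (x : X.carrier) : R (X.lact a x) = πA a ∘L R x := by
    ext v
    simp [hR, X.linner_lact]
  exact exists_repStronglyMoritaEquivalent_of_rows X πA hA R hRR hRl

end CStarMorita

/-! ### Kolmogorov decompositions and minimal Stinespring representations -/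

namespace CStarMorita

open ContinuousLinearMap (adjoint)

section Extension

variable {ι H E F : Type*}
  [NormedAddCommGroup H] [InnerProductSpace ℂ H] [CompleteSpace H]
  [NormedAddCommGroup E] [InnerProductSpace ℂ E] [CompleteSpace E]
  [NormedAddCommGroup F] [InnerProductSpace ℂ F] [CompleteSpace F]
  {k : ι → H →L[ℂ] E}

omit [CompleteSpace H] [CompleteSpace E] in
/-- A bounded operator may be prescribed on the dense span of the ranges of a family of
operators. -/
lemma exists_operator_of_norm_sum_le
    (hk : (Submodule.span ℂ {ξ : E | ∃ (i : ι) (h : H), ξ = k i h}).topologicalClosure = ⊤)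
    (l : ι → H →L[ℂ] F) (r : ℝ)
    (hl : ∀ v : ι →₀ H, ‖v.sum fun i h => l i h‖ ≤ r * ‖v.sum fun i h => k i h‖) :
    ∃ T : E →L[ℂ] F, ∀ i h, T (k i h) = l i h := by
  classical
  let e : (ι →₀ H) →ₗ[ℂ] E := Finsupp.lsum ℂ fun i => (k i : H →ₗ[ℂ] E)
  let f : (ι →₀ H) →ₗ[ℂ] F := Finsupp.lsum ℂ fun i => (l i : H →ₗ[ℂ] F)
  have he : DenseRange e := by
    have : Dense (Submodule.span ℂ {ξ : E | ∃ (i : ι) (h : H), ξ = k i h} : Set E) :=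
      Submodule.dense_iff_topologicalClosure_eq_top.mpr hk
    refine this.mono ?_
    change ((Submodule.span ℂ _ : Submodule ℂ E) : Set E) ⊆ (e.range : Set E)
    refine SetLike.coe_subset_coe.mpr (Submodule.span_le.mpr ?_)
    rintro _ ⟨i, h, rfl⟩
    exact ⟨Finsupp.single i h, by simp [e]⟩
  refine ⟨f.extendOfNorm e, fun i h => ?_⟩
  have := LinearMap.extendOfNorm_eq (f := f) he ⟨r, hl⟩ (Finsupp.single i h)
  simpa [e, f] using this

lemma eq_of_forall_adjoint_eq
    (hk : (Submodule.span ℂ {ξ : E | ∃ (i : ι) (h : H), ξ = k i h}).topologicalClosure = ⊤)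
    {x y : E} (h : ∀ i, adjoint (k i) x = adjoint (k i) y) : x = y := by
  have hd : Dense (Submodule.span ℂ {ξ : E | ∃ (i : ι) (h : H), ξ = k i h} : Set E) :=
    Submodule.dense_iff_topologicalClosure_eq_top.mpr hk
  refine hd.eq_of_inner_right ℂ fun v hv => ?_
  induction hv using Submodule.span_induction with
  | mem v hv =>
    obtain ⟨i, w, rfl⟩ := hv
    rw [← ContinuousLinearMap.adjoint_inner_right, h, ContinuousLinearMap.adjoint_inner_right]
  | zero => simp
  | add v w _ _ hv hw => rw [inner_add_left, inner_add_left, hv, hw]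
  | smul c v _ hv => rw [inner_smul_left, inner_smul_left, hv]

/-- Norms of combinations depend only on the kernel `(k i)* (k j)`, so bounds between families
reduce to comparing kernels. -/
lemma norm_sum_sq_eq (k : ι → H →L[ℂ] E) (v : ι →₀ H) :
    ((‖v.sum fun i h => k i h‖ ^ 2 : ℝ) : ℂ) =
      v.sum fun i h => v.sum fun j h' => ⟪h, (adjoint (k i) ∘L k j) h'⟫_ℂ := by
  have := inner_self_eq_norm_sq_to_K (𝕜 := ℂ) (v.sum fun i h => k i h)
  push_cast
  rw [← Complex.coe_algebraMap, ← this]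
  have h (i j : ι) (x y : H) : ⟪k i x, k j y⟫_ℂ = ⟪x, (adjoint (k i) ∘L k j) y⟫_ℂ :=
    (ContinuousLinearMap.adjoint_inner_right (k i) x (k j y)).symm
  simp only [Finsupp.sum, sum_inner, inner_sum, h]
  exact Finset.sum_comm

end Extension

variable {A : Type u} [CStarAlgebra A] [PartialOrder A] [StarOrderedRing A]

lemma exists_eq_star_mul_self {M : Type*} [NonUnitalCStarAlgebra M] [PartialOrder M]
    [StarOrderedRing M] {a : M} (h : 0 ≤ a) :
    ∃ b, a = star b * b := CStarAlgebra.nonneg_iff_eq_star_mul_self.mp h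

lemma CPMapOn.sum_inner_nonneg (φ : CPMapOn A) {ι : Type*} [Fintype ι] (a : ι → A)
    (h : ι → φ.space) : 0 ≤ ∑ i, ∑ j, ⟪h i, φ.map (star (a i) * a j) (h j)⟫_ℂ := by
  classical
  rcases isEmpty_or_nonempty ι with hι | ⟨⟨i₀⟩⟩
  · simp
  -- The row `a` is padded to a square matrix `N`, so that `(a i)* (a j)` are the entries of the
  -- positive matrix `N* N`; complete positivity applies to it.
  obtain ⟨N, hNa⟩ : ∃ N : CStarMatrix ι ι A, ∀ i j, N i j = if i = i₀ then a j else 0 :=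
    ⟨fun i j => if i = i₀ then a j else 0, fun _ _ => rfl⟩
  have hN (i j : ι) : (star N * N) i j = star (a i) * a j := by
    rw [CStarMatrix.mul_apply, Finset.sum_eq_single i₀]
    · simp [hNa, CStarMatrix.star_apply]
    · intro l _ hl
      simp [hNa, hl]
    · simp
  have hpos := φ.map.map_cstarMatrix_nonneg (star N * N) (star_mul_self_nonneg N)
  obtain ⟨P, hP⟩ := exists_eq_star_mul_self hpos
  have hφ (i j : ι) : φ.map (star (a i) * a j) = ∑ l, adjoint (P l i) ∘L P l j := by
    have := congr($hP i j)
    rw [CStarMatrix.map_apply, hN, CStarMatrix.mul_apply] at this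
    rw [this]
    rfl
  have : ∑ i, ∑ j, ⟪h i, φ.map (star (a i) * a j) (h j)⟫_ℂ =
      ∑ l, ⟪∑ i, P l i (h i), ∑ j, P l j (h j)⟫_ℂ := by
    simp only [hφ, sum_apply, inner_sum, sum_inner, ContinuousLinearMap.comp_apply,
      ContinuousLinearMap.adjoint_inner_right]
    rw [Finset.sum_comm_cycle]
    refine Finset.sum_congr rfl fun l _ => Finset.sum_comm
  rw [this]
  exact Finset.sum_nonneg fun l _ => by
    rw [← inner_self_ofReal_norm (𝕜 := ℂ)]
    exact RCLike.ofReal_nonneg.mpr (norm_nonneg _)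

/-- A family of operators realizing the kernel `(a, b) ↦ φ(a* b)` with dense span. -/
structure IsKolmogorov (φ : CPMapOn A) {E : Type u} [NormedAddCommGroup E]
    [InnerProductSpace ℂ E] [CompleteSpace E] (k : A → φ.space →L[ℂ] E) : Prop where
  adjoint_comp (a b : A) : adjoint (k a) ∘L k b = φ.map (star a * b)
  dense : (Submodule.span ℂ {ξ : E | ∃ (a : A) (h : φ.space), ξ = k a h}).topologicalClosure = ⊤

lemma CPMapOn.exists_isKolmogorov (φ : CPMapOn A) :
    ∃ (E : Type u) (_ : NormedAddCommGroup E) (_ : InnerProductSpace ℂ E) (_ : CompleteSpace E)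
      (k : A → φ.space →L[ℂ] E), IsKolmogorov φ k := by
  let K : Matrix A A (φ.space →L[ℂ] φ.space) := Matrix.of fun a b => φ.map (star a * b)
  have hφs (a : A) : star (φ.map a) = φ.map (star a) := (map_star φ.map a).symm
  have hK : K.PosSemidef := by
    -- This criterion asks for Hermitian symmetry and nonnegative quadratic forms on finitely
    -- supported vectors.
    have htfae := (RKHS.posSemidef_tfae (𝕜 := ℂ) (K := K)).out 0 2
    refine htfae.mpr ⟨?_, fun v => ?_⟩
    · ext1 a b
      simp [K, hφs]
    · have h := φ.sum_inner_nonneg (fun i : v.support => (i : A)) (fun i => v i)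
      have hsum : ∑ i : v.support, ∑ j : v.support, ⟪v i, φ.map (star (i : A) * j) (v j)⟫_ℂ =
          ∑ i ∈ v.support, ∑ j ∈ v.support, ⟪v i, φ.map (star i * j) (v j)⟫_ℂ := by
        refine Eq.trans (Finset.sum_congr rfl fun i _ => Finset.sum_coe_sort v.support
          (fun j => ⟪v i, φ.map (star (i : A) * j) (v j)⟫_ℂ)) ?_
        exact Finset.sum_coe_sort v.support
          (fun i => ∑ j ∈ v.support, ⟪v i, φ.map (star i * j) (v j)⟫_ℂ)
      rw [hsum] at h
      have h' := (Complex.le_def.mp h).1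
      rw [Finset.sum_comm] at h'
      change 0 ≤ RCLike.re (∑ x ∈ v.support, ∑ x' ∈ v.support, ⟪φ.map (star x' * x) (v x), v x'⟫_ℂ)
      simp only [map_sum, inner_re_symm (𝕜 := ℂ) (φ.map _ _)]
      simpa using h'
  have : Fact K.PosSemidef := ⟨hK⟩
  refine ⟨RKHS.OfKernel K, inferInstance, inferInstance, inferInstance,
    fun a => RKHS.kerFun (𝕜 := ℂ) (RKHS.OfKernel K) a, fun a b => ?_, ?_⟩
  · rw [← RKHS.kernel_apply, RKHS.OfKernel.kernel_ofKernel]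
    rfl
  · simpa only [eq_comm] using RKHS.kerFun_dense (𝕜 := ℂ) (RKHS.OfKernel K)

namespace IsKolmogorov

variable {φ : CPMapOn A} {E F : Type u}
  [NormedAddCommGroup E] [InnerProductSpace ℂ E] [CompleteSpace E]
  [NormedAddCommGroup F] [InnerProductSpace ℂ F] [CompleteSpace F]
  {k : A → φ.space →L[ℂ] E} {l : A → φ.space →L[ℂ] F} (hk : IsKolmogorov φ k)
  (hl : IsKolmogorov φ l)

include hk

lemma adjoint_comp_apply (a b : A) (h : φ.space) :
    adjoint (k a) (k b h) = φ.map (star a * b) h := by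
  rw [← hk.adjoint_comp]; rfl

/-- Choosing `d` with `c* c + d* d = ‖c‖²`, the squared norms of the `c`- and `d`-translates of a
combination add up to `‖c‖²` times its own, so left translation by `c` is bounded by `‖c‖`. -/
lemma exists_mul_left (c : A) : ∃ T : E →L[ℂ] E, ∀ a h, T (k a h) = k (c * a) h := by
  obtain ⟨d, hd⟩ := AlgebraicBimodule.exists_star_mul_self_add (star_mul_self_nonneg c)
  refine exists_operator_of_norm_sum_le hk.dense (fun a => k (c * a)) ‖c‖ fun v => ?_
  have h1 := norm_sum_sq_eq (fun a => k (c * a)) v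
  have h2 := norm_sum_sq_eq (fun a => k (d * a)) v
  have h3 := norm_sum_sq_eq k v
  have h4 : ‖v.sum fun a h => k (c * a) h‖ ^ 2 + ‖v.sum fun a h => k (d * a) h‖ ^ 2 =
      ‖c‖ ^ 2 * ‖v.sum fun a h => k a h‖ ^ 2 := by
    apply Complex.ofReal_injective
    rw [Complex.ofReal_add, Complex.ofReal_mul, h1, h2, h3]
    simp only [hk.adjoint_comp, Finsupp.sum, Finset.mul_sum, ← Finset.sum_add_distrib,
      ← inner_add_right, ← add_apply, ← map_add]
    refine Finset.sum_congr rfl fun a _ => Finset.sum_congr rfl fun b _ => ?_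
    have : star (c * a) * (c * b) + star (d * a) * (d * b) = ((‖c‖ ^ 2 : ℝ) : ℂ) • (star a * b) := by
      rw [CStarRing.norm_star_mul_self, ← sq] at hd
      have : star (c * a) * (c * b) + star (d * a) * (d * b) =
          star a * (star c * c + star d * d) * b := by
        simp only [star_mul]; noncomm_ring
      rw [this, hd]
      simp [← Complex.coe_smul]
    rw [this, map_smul, smul_apply, inner_smul_right]
  refine (pow_le_pow_iff_left₀ (norm_nonneg _) (by positivity) two_ne_zero).mp ?_
  rw [mul_pow, ← h4]
  exact le_add_of_nonneg_right (by positivity)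

include hl in
/-- Uniqueness of the Kolmogorov decomposition up to a unitary. -/
lemma exists_unitary : ∃ U : E →L[ℂ] F, (∀ a h, U (k a h) = l a h) ∧
    adjoint U ∘L U = 1 ∧ U ∘L adjoint U = 1 := by
  obtain ⟨U, hU⟩ := exists_operator_of_norm_sum_le hk.dense l 1 fun v => by
    have h : ((‖v.sum fun i h => l i h‖ ^ 2 : ℝ) : ℂ) = ((‖v.sum fun i h => k i h‖ ^ 2 : ℝ) : ℂ) := by
      rw [norm_sum_sq_eq, norm_sum_sq_eq]
      simp only [hk.adjoint_comp, hl.adjoint_comp]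
    rw [one_mul, ← pow_le_pow_iff_left₀ (norm_nonneg _) (norm_nonneg _) two_ne_zero]
    exact (Complex.ofReal_injective h).le
  have hUk (a : A) : U ∘L k a = l a := by ext h; exact hU a h
  have hUa (a : A) (x : F) : adjoint (k a) (adjoint U x) = adjoint (l a) x := by
    rw [← hUk, ContinuousLinearMap.adjoint_comp]; rfl
  have hUl (a : A) (h : φ.space) : adjoint U (l a h) = k a h :=
    eq_of_forall_adjoint_eq hk.dense fun b => by
      rw [hUa, hl.adjoint_comp_apply, hk.adjoint_comp_apply]
  refine ⟨U, hU, ?_, ?_⟩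
  · refine ContinuousLinearMap.ext_on (Submodule.dense_iff_topologicalClosure_eq_top.mpr hk.dense) ?_
    rintro _ ⟨a, h, rfl⟩
    rw [ContinuousLinearMap.comp_apply, hU, hUl, one_apply_eq_self]
  · refine ContinuousLinearMap.ext_on (Submodule.dense_iff_topologicalClosure_eq_top.mpr hl.dense) ?_
    rintro _ ⟨a, h, rfl⟩
    rw [ContinuousLinearMap.comp_apply, hUl, hU, one_apply_eq_self]

/-- `A` acts by left translation of the index, and `V = k 1`. -/
lemma exists_minimalStinespring : Nonempty (MinimalStinespring φ) := by
  choose T hT using hk.exists_mul_left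
  -- By density, operator identities may be tested on matrix coefficients between the `k a`, which
  -- are values of `φ`.
  have hext {S S' : E →L[ℂ] E} (h : ∀ a v b, adjoint (k b) (S (k a v)) = adjoint (k b) (S' (k a v))) :
      S = S' := by
    refine ContinuousLinearMap.ext_on (Submodule.dense_iff_topologicalClosure_eq_top.mpr hk.dense) ?_
    rintro _ ⟨a, v, rfl⟩
    exact eq_of_forall_adjoint_eq hk.dense (h a v)
  have hTk (c a : A) : T c ∘L k a = k (c * a) := by ext h; exact hT c a h
  let π : A →⋆ₙₐ[ℂ] (E →L[ℂ] E) :=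
    { toFun := T
      map_smul' := fun c a => hext fun b v d => by
        simp [hT, hk.adjoint_comp_apply]
      map_zero' := hext fun b v d => by
        simp [hT, hk.adjoint_comp_apply]
      map_add' := fun a a' => hext fun b v d => by
        simp [hT, hk.adjoint_comp_apply, add_mul, mul_add]
      map_mul' := fun a a' => hext fun b v d => by
        simp [hT, mul_assoc]
      map_star' := fun a => hext fun b v d => by
        have : adjoint (k d) (star (T a) (k b v)) = adjoint (k (a * d)) (k b v) := by
          rw [← hTk, ContinuousLinearMap.adjoint_comp]; rfl
        rw [this, hT, hk.adjoint_comp_apply, hk.adjoint_comp_apply]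
        simp [mul_assoc] }
  have hπ (a b : A) (h : φ.space) : π a (k b h) = k (a * b) h := hT a b h
  refine ⟨{ space := E, rep := π, V := k 1, map_eq := fun a => ?_, dense_span := ?_ }⟩
  · ext h
    simp [hπ, hk.adjoint_comp_apply]
  · simpa only [hπ, mul_one] using hk.dense

end IsKolmogorov

instance (φ : CPMapOn A) : Nonempty (MinimalStinespring φ) := by
  obtain ⟨E, _, _, _, k, hk⟩ := φ.exists_isKolmogorov
  exact hk.exists_minimalStinespring

namespace MinimalStinespring

variable {φ : CPMapOn A} (S T : MinimalStinespring φ)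

lemma isNondegenerate : IsNondegenerate S.rep := by
  rw [IsNondegenerate, eq_top_iff, ← S.dense_span]
  refine Submodule.topologicalClosure_mono (Submodule.span_mono ?_)
  rintro _ ⟨a, h, rfl⟩
  exact ⟨a, _, rfl⟩

/-- Reduces uniqueness of the dilation to uniqueness of the Kolmogorov decomposition. -/
lemma isKolmogorov : IsKolmogorov φ fun a => S.rep a ∘L S.V where
  adjoint_comp a b := by
    rw [S.map_eq, ContinuousLinearMap.adjoint_comp, map_mul, map_star]
    rfl
  dense := S.dense_span

/-- Minimal Stinespring representations are unique up to unitary equivalence. -/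
lemma exists_unitary : ∃ U : S.space →L[ℂ] T.space,
    adjoint U ∘L U = 1 ∧ U ∘L adjoint U = 1 ∧ ∀ a, U ∘L S.rep a = T.rep a ∘L U := by
  obtain ⟨U, hU, h1, h2⟩ := S.isKolmogorov.exists_unitary T.isKolmogorov
  refine ⟨U, h1, h2, fun a => ?_⟩
  refine ContinuousLinearMap.ext_on
    (Submodule.dense_iff_topologicalClosure_eq_top.mpr S.dense_span) ?_
  rintro _ ⟨b, h, rfl⟩
  have hS := hU (a * b) h
  have hT := hU b h
  simp only [map_mul] at hS
  simp only [ContinuousLinearMap.comp_apply, mul_apply_eq_comp] at hS hT ⊢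
  rw [hS, hT]

end MinimalStinespring

end CStarMorita

/-! ### Equivalence classes of completely positive maps -/

namespace CStarMorita

variable {A B C : Type u}
  [CStarAlgebra A] [PartialOrder A] [StarOrderedRing A]
  [CStarAlgebra B] [PartialOrder B] [StarOrderedRing B]
  [CStarAlgebra C] [PartialOrder C] [StarOrderedRing C]

namespace CPStronglyMoritaEquivalent

lemma refl (φ : CPMapOn A) : CPStronglyMoritaEquivalent φ φ := by
  obtain ⟨S⟩ := (inferInstance : Nonempty (MinimalStinespring φ))
  exact ⟨S, S, .refl S.isNondegenerate⟩

lemma symm {φ : CPMapOn A} {ψ : CPMapOn B} (h : CPStronglyMoritaEquivalent φ ψ) :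
    CPStronglyMoritaEquivalent ψ φ := by
  obtain ⟨S, T, h⟩ := h
  exact ⟨T, S, h.symm⟩

lemma trans {φ : CPMapOn A} {ψ : CPMapOn B} {χ : CPMapOn C}
    (h : CPStronglyMoritaEquivalent φ ψ) (h' : CPStronglyMoritaEquivalent ψ χ) :
    CPStronglyMoritaEquivalent φ χ := by
  obtain ⟨S, T, h⟩ := h
  obtain ⟨T', R, h'⟩ := h'
  -- The two hypotheses may use different dilations of `ψ`; the unitary identifies them.
  obtain ⟨U, hU, hU', hπ⟩ := T.exists_unitary T'
  exact ⟨S, R, (h.of_unitary_right U hU hU' hπ).trans h'⟩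

lemma equivalence (A : Type u) [CStarAlgebra A] [PartialOrder A] [StarOrderedRing A] :
    Equivalence (fun φ φ' : CPMapOn A => CPStronglyMoritaEquivalent φ φ') :=
  ⟨refl, symm, trans⟩

end CPStronglyMoritaEquivalent

/-- A representation, regarded as a completely positive map. -/
noncomputable def CPMapOn.ofRep {K : Type u} [NormedAddCommGroup K] [InnerProductSpace ℂ K]
    [CompleteSpace K] (π : A →⋆ₙₐ[ℂ] (K →L[ℂ] K)) : CPMapOn A where
  space := K
  map := CompletelyPositiveMapClass.toCompletelyPositiveLinearMap π

/-- A nondegenerate representation is its own minimal Stinespring representation. -/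
noncomputable def MinimalStinespring.ofRep {K : Type u} [NormedAddCommGroup K]
    [InnerProductSpace ℂ K] [CompleteSpace K] (π : A →⋆ₙₐ[ℂ] (K →L[ℂ] K))
    (h : IsNondegenerate π) : MinimalStinespring (CPMapOn.ofRep π) where
  space := K
  rep := π
  V := ContinuousLinearMap.id ℂ K
  map_eq a := by
    have h : π a = ContinuousLinearMap.adjoint (ContinuousLinearMap.id ℂ K) ∘L π a ∘L
        ContinuousLinearMap.id ℂ K := by
      rw [ContinuousLinearMap.adjoint_id]
      rfl
    exact h
  dense_span := h

lemma exists_cpStronglyMoritaEquivalent (X : EquivalenceBimodule A B) (φ : CPMapOn A) :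
    ∃ ψ : CPMapOn B, CPStronglyMoritaEquivalent φ ψ := by
  obtain ⟨S⟩ := (inferInstance : Nonempty (MinimalStinespring φ))
  obtain ⟨K, _, _, _, πB, h⟩ := exists_repStronglyMoritaEquivalent X S.rep S.isNondegenerate
  have hB : IsNondegenerate πB := by
    obtain ⟨_, _, h⟩ := h
    exact h.nondegenerate_right
  exact ⟨CPMapOn.ofRep πB, S, .ofRep πB hB, h⟩

lemma CPMapOn.toClass_eq_iff {φ φ' : CPMapOn A} :
    φ.toClass = φ'.toClass ↔ CPStronglyMoritaEquivalent φ φ' :=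
  (CPStronglyMoritaEquivalent.equivalence A).quot_mk_eq_iff φ φ'

end CStarMorita

open CStarMorita in
theorem corollary6p6 {A B : Type u}
    [CStarAlgebra A] [PartialOrder A] [StarOrderedRing A]
    [CStarAlgebra B] [PartialOrder B] [StarOrderedRing B]
    (hAB : CStarMorita.StronglyMoritaEquivalent A B) :
    Equivalence (fun φ φ' : CStarMorita.CPMapOn A =>
        CStarMorita.CPStronglyMoritaEquivalent φ φ') ∧
      Equivalence (fun ψ ψ' : CStarMorita.CPMapOn B =>
        CStarMorita.CPStronglyMoritaEquivalent ψ ψ') ∧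
      ∃ e : CStarMorita.CPClasses A ≃ CStarMorita.CPClasses B,
        ∀ (φ : CStarMorita.CPMapOn A) (ψ : CStarMorita.CPMapOn B),
          e φ.toClass = ψ.toClass ↔ CStarMorita.CPStronglyMoritaEquivalent φ ψ := by
  obtain ⟨X⟩ := hAB
  refine ⟨CPStronglyMoritaEquivalent.equivalence A, CPStronglyMoritaEquivalent.equivalence B, ?_⟩
  -- Any choice of representatives will do: transitivity makes the maps well defined on classes and
  -- mutually inverse.
  choose F hF using exists_cpStronglyMoritaEquivalent X
  choose G hG using exists_cpStronglyMoritaEquivalent X.conj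
  refine ⟨{
    toFun := Quot.lift (fun φ => (F φ).toClass) fun φ φ' h =>
      CPMapOn.toClass_eq_iff.mpr ((hF φ).symm.trans (h.trans (hF φ')))
    invFun := Quot.lift (fun ψ => (G ψ).toClass) fun ψ ψ' h =>
      CPMapOn.toClass_eq_iff.mpr ((hG ψ).symm.trans (h.trans (hG ψ')))
    left_inv := ?_
    right_inv := ?_ }, fun φ ψ => ?_⟩
  · rintro ⟨φ⟩
    exact CPMapOn.toClass_eq_iff.mpr ((hF φ).trans (hG (F φ))).symm
  · rintro ⟨ψ⟩
    exact CPMapOn.toClass_eq_iff.mpr ((hG ψ).trans (hF (G ψ))).symm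
  · exact CPMapOn.toClass_eq_iff.trans ⟨(hF φ).trans, (hF φ).symm.trans⟩
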